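/- In the coordinator (star) model there are $k$ players, each holding a private input, and a coordinator without input; each player is joined to the coordinator by a private channel, all $k+1$ parties have independent private coins, and the coordinator announces the answer. A protocol has error at most $\delta$ if on every input the answer is wrong with probability at most $\delta$ over the coins; its communication cost is the total number of bits sent over all channels, in the worst case over inputs and coins. For a $k\times n$ Boolean matrix whose $i$-th row is the input of player $i$, let $\mathsf{Disj}_n$ be $1$ if and only if some column has no zeroes. For a $k\times m\ell$ Boolean matrix split into $m$ submatrices $A_1,\dots,A_m$ of dimension $k\times\ell$, let $\mathsf{Tribes}_{m,\ell}=\bigwedge_{a=1}^m \mathsf{Disj}_\ell(A_a)$. Theorem. For every $\delta<1/2$ there is a constant $c=c(\delta)>0$ such that for all $k\ge 2$, $m\ge 1$ and $\ell\ge 2$, every private-coin randomized protocol with error at most $\delta$ for $\mathsf{Tribes}_{m,\ell}$ with $k$ players in the coordinator model has communication cost at least $c\,m\ell k$. In particular (case $m=1$, $\ell=n$), every such protocol for $k$-party Set-Disjointness $\mathsf{Disj}_n$ has communication cost at least $c\,kn$, for all $k\ge 2$ and $n\ge 2$; the same bound holds for $n=1$. -/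

import Mathlib

open MeasureTheory
open scoped ENNReal

/-- One bit sent over the private channel joining a player to the coordinator. -/
structure ChannelBit (k : ℕ) where
  /-- the player whose channel is used -/
  channel : Fin k
  /-- `true` if the player is the sender, `false` if the coordinator is the sender -/
  fromPlayer : Bool
  /-- the transmitted bit -/
  bit : Bool

/-- What the coordinator can do next: send one bit to a player, receive one bit from a player,
or stop and announce the (one-bit) answer. -/
inductive CoordMove (k : ℕ) where
  | send (i : Fin k) (b : Bool)
  | receive (i : Fin k)
  | output (b : Bool)

/-- A private-coin protocol in the `k`-player coordinator (star) model, for players whose inputs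
are elements of `X`. The coordinator has no input and sees every bit that is sent; her next move
depends on her own coins and on the whole history. A bit sent by player `i` depends only on that
player's input, that player's coins, and the bits previously exchanged over channel `i`.
Histories are lists in chronological order. Coin spaces are arbitrary probability spaces; that
the strategies are measurable in the coins is part of being a protocol. -/
structure StarProtocol (k : ℕ) (X : Type) where
  /-- coin space of the coordinator -/
  CoordCoins : Type
  /-- coin spaces of the players -/
  PlayerCoins : Fin k → Type
  [measCoord : MeasurableSpace CoordCoins]
  [measPlayer : ∀ i, MeasurableSpace (PlayerCoins i)]
  /-- law of the coordinator's coins -/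
  coordLaw : Measure CoordCoins
  /-- laws of the players' coins -/
  playerLaw : ∀ i, Measure (PlayerCoins i)
  [probCoord : IsProbabilityMeasure coordLaw]
  [probPlayer : ∀ i, IsProbabilityMeasure (playerLaw i)]
  /-- strategy of the coordinator -/
  next : CoordCoins → List (ChannelBit k) → CoordMove k
  /-- strategy of player `i`: the bit sent when the coordinator receives from channel `i`, given
  the input, the coins and the history of channel `i` -/
  reply : ∀ i, X → PlayerCoins i → List (ChannelBit k) → Bool
  measurable_next : ∀ h a, MeasurableSet {r | next r h = a}
  measurable_reply : ∀ i x v b, MeasurableSet {r | reply i x r v = b}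

namespace StarProtocol

attribute [instance] measCoord measPlayer probCoord probPlayer

variable {k : ℕ} {X : Type} (P : StarProtocol k X)

/-- An outcome of all coin tosses: the coordinator's coins and each player's coins. -/
abbrev Coins : Type := P.CoordCoins × (∀ i, P.PlayerCoins i)

/-- The coins of the `k + 1` parties are independent. -/
noncomputable def coinLaw : Measure P.Coins :=
  P.coordLaw.prod (Measure.pi P.playerLaw)

/-- The part of a history that player `i` sees: the bits exchanged over channel `i`. -/
def view (i : Fin k) (h : List (ChannelBit k)) : List (ChannelBit k) :=
  h.filter (fun e => e.channel = i)

/-- One step of the execution on inputs `x` with coins `r`, from the history `h`; the history does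
not change any more once the coordinator has stopped. -/
def step (x : Fin k → X) (r : P.Coins) (h : List (ChannelBit k)) : List (ChannelBit k) :=
  match P.next r.1 h with
  | .send i b => h ++ [⟨i, false, b⟩]
  | .receive i => h ++ [⟨i, true, P.reply i (x i) (r.2 i) (view i h)⟩]
  | .output _ => h

/-- The history after `t` steps. -/
def history (x : Fin k → X) (r : P.Coins) : ℕ → List (ChannelBit k)
  | 0 => []
  | t + 1 => P.step x r (history x r t)

/-- On inputs `x` and coins `r` the coordinator eventually stops, with answer `b`. -/
def Outputs (x : Fin k → X) (r : P.Coins) (b : Bool) : Prop :=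
  ∃ t, P.next r.1 (P.history x r t) = .output b

/-- The total number of bits sent over all channels on inputs `x` with coins `r`
(it is `⊤` if the coordinator never stops). -/
noncomputable def bits (x : Fin k → X) (r : P.Coins) : ℕ∞ :=
  ⨆ t, ((P.history x r t).length : ℕ∞)

/-- The communication cost: the worst case over all inputs and all coins. -/
noncomputable def cost : ℕ∞ := ⨆ x, ⨆ r, P.bits x r

/-- On every input, the probability (over the private coins) that the coordinator does not
announce the value `f x` is at most `δ`. -/
def ComputesWithError (f : (Fin k → X) → Bool) (δ : ℝ) : Prop :=
  ∀ x, P.coinLaw.real {r | ¬ P.Outputs x r (f x)} ≤ δ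

end StarProtocol

/-- `k`-party Set-Disjointness on the `k × n` Boolean matrix whose `i`-th row is the input of
player `i`: the value is `1` iff some column has no zeroes. -/
def setDisj (k n : ℕ) (x : Fin k → Fin n → Bool) : Bool :=
  decide (∃ j, ∀ i, x i j = true)

/-- `Tribes_{m,ℓ}`: every row is split into `m` blocks of length `ℓ`, and the value is `1` iff
Set-Disjointness is `1` on each of the `m` submatrices of dimension `k × ℓ`. -/
def tribes (k m ℓ : ℕ) (x : Fin k → Fin m → Fin ℓ → Bool) : Bool :=
  decide (∀ a, setDisj k ℓ (fun i => x i a) = true)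

/-! ### Scalar inequalities -/

/-! The bound is an information argument carried out cell by cell. In the hard distribution every
block has one planted all-one column, given by `W`. Every other column has one player, given by `Z`,
whose cell is frozen to zero, and a hidden mode: its free cells are all one in mode `true`
(probability 1/3) and independent fair bits in mode `false`. Given the modes the rows are
independent, so by the rectangle property the law of the view `v` of player `i` is a product `R v M
* Q v x` of a function of the modes and a function of the row of `i`.

Upper bound on effects. The entropy of a view is controlled by its length, and the chain rule
distributes it over the columns in two ways: averaging out cells given modes along an order `σ`, or
modes given cells along the opposite order. For a free cell this bounds, in squared Hellinger
distance, the effect of cell 0 versus 1 in mode `false`, and of mode `false` versus `true` with cell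
1. Thanks to the opposite orders both bounds can be transferred to one conditioning: earlier columns
have their cells averaged given the modes, later ones their modes given the cells, so the product of
`R` and `Q` survives. Cut and paste (`hellSq_fourth_corner`) then bounds the flip of the cell in
mode `true`, where all other players but the marked one hold ones. In total these effects are at
most a constant times the code length of all views (`sum_flipEffect_le`,
`TranscriptLaw.sum_effect_le`).

Lower bound on effects. Take an unplanted column `b`, the planted column `c` of the same block and
two players `i`, `j`. Four single flips, starting from inputs where one of the two columns is all
one and the other has zeros exactly at `i` and `j`, control by cut and paste (`hellSq_rectangle_le`)
the passage from "`b` has a zero at `i`, `c` a zero at `j`" to "both all one". This passage changes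
the value of the function, so it has constant distance (`TranscriptLaw.sq_le_sum_effect`).
Exchanging `b` and `c` permutes the pairs of planting and order, so summing over all choices gives
`m (ℓ - 1) (k - 1) ≲ Λ` (`TranscriptLaw.tribes_le_sum_len`).

Encoding the views costs a constant per player beyond the communication `T`, so `Λ` is of order `T +
k`. The term `k` is absorbed by a separate bound (`StarProtocol.players_le_cost`): on the all-one
input each channel is used with probability at least `1 - 2δ`, because zeroing that row changes the
value. -/

theorem mul_log_tangent {x z : ℝ} (hx : 0 ≤ x) (hz : 0 < z) :
    z * Real.log z + (1 + Real.log z) * (x - z) + (√x - √z) ^ 2 ≤ x * Real.log x := by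
  rcases hx.eq_or_lt with rfl | hx
  · simp [Real.sq_sqrt hz.le]; ring_nf; rfl
  · have hsx : 0 < √x := Real.sqrt_pos.2 hx
    have hsz : 0 < √z := Real.sqrt_pos.2 hz
    -- Since `log x = 2 log √x`, the bound `1 - 1/t ≤ log t` at `t = √x/√z`, multiplied by `2x`,
    -- leaves exactly the squared difference of roots above the tangent.
    have h1 := Real.one_sub_inv_le_log_of_pos (div_pos hsx hsz)
    rw [Real.log_div hsx.ne' hsz.ne', Real.log_sqrt hx.le, Real.log_sqrt hz.le, inv_div] at h1
    have h2 := mul_le_mul_of_nonneg_left h1 (by positivity : 0 ≤ 2 * x)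
    have h3 : 2 * x * (1 - √z / √x) = 2 * x - 2 * (√x * √z) := by
      have : x * (√z / √x) = √x * √z := by
        rw [← mul_div_assoc, div_eq_iff hsx.ne']
        nth_rewrite 1 [← Real.mul_self_sqrt hx.le]
        ring
      linear_combination (-2) * this
    rw [h3] at h2
    nlinarith [Real.sq_sqrt hx.le, Real.sq_sqrt hz.le]

/-- The Jensen gap of `x log x` for a two-point law dominates the squared Hellinger distance. -/
theorem mul_log_gap {p x y : ℝ} (hp0 : 0 ≤ p) (hp1 : p ≤ 1) (hx : 0 ≤ x) (hy : 0 ≤ y) :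
    p * (1 - p) * (√x - √y) ^ 2 ≤
      (1 - p) * (x * Real.log x) + p * (y * Real.log y)
        - ((1 - p) * x + p * y) * Real.log ((1 - p) * x + p * y) := by
  set z := (1 - p) * x + p * y with hz
  have hp' : 0 ≤ 1 - p := by linarith
  have hz0 : 0 ≤ z := by positivity
  rcases hz0.eq_or_lt with h0 | h0
  · rw [← h0]
    have h1 : (1 - p) * x = 0 := by nlinarith [mul_nonneg hp' hx, mul_nonneg hp0 hy]
    have h2 : p * y = 0 := by nlinarith [mul_nonneg hp' hx, mul_nonneg hp0 hy]
    rw [← mul_assoc, ← mul_assoc, h1, h2]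
    rcases mul_eq_zero.1 h1 with h | h
    · simp [h]
    · rcases mul_eq_zero.1 h2 with h' | h'
      · simp [h']
      · simp [h, h']
  · have hX := mul_le_mul_of_nonneg_left (mul_log_tangent hx h0) hp'
    have hY := mul_le_mul_of_nonneg_left (mul_log_tangent hy h0) hp0
    -- The variance of a two-point law is at most its second moment about `√z`.
    have key : p * (1 - p) * (√x - √y) ^ 2 ≤
        (1 - p) * (√x - √z) ^ 2 + p * (√y - √z) ^ 2 := by
      nlinarith [sq_nonneg (√z - ((1 - p) * √x + p * √y))]
    have : (1 - p) * (z * Real.log z + (1 + Real.log z) * (x - z))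
        + p * (z * Real.log z + (1 + Real.log z) * (y - z)) = z * Real.log z := by
      have : (1 - p) * (x - z) + p * (y - z) = 0 := by rw [hz]; ring
      linear_combination (1 + Real.log z) * this
    linarith

/-- Joint convexity of the squared Hellinger integrand. It is homogeneous of degree one, so the
weights need not sum to one; Cauchy–Schwarz handles the cross term. -/
theorem sq_sqrt_sub_sqrt_sum_le {ι : Type*} (s : Finset ι) {w x y : ι → ℝ}
    (hw : ∀ i ∈ s, 0 ≤ w i) (hx : ∀ i, 0 ≤ x i) (hy : ∀ i, 0 ≤ y i) :
    (√(∑ i ∈ s, w i * x i) - √(∑ i ∈ s, w i * y i)) ^ 2 ≤ ∑ i ∈ s, w i * (√(x i) - √(y i)) ^ 2 := by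
  have hX : 0 ≤ ∑ i ∈ s, w i * x i := Finset.sum_nonneg fun i hi => mul_nonneg (hw i hi) (hx i)
  have hY : 0 ≤ ∑ i ∈ s, w i * y i := Finset.sum_nonneg fun i hi => mul_nonneg (hw i hi) (hy i)
  have hcs : ∑ i ∈ s, w i * (√(x i) * √(y i)) ≤ √(∑ i ∈ s, w i * x i) * √(∑ i ∈ s, w i * y i) := by
    have h := Finset.sum_mul_sq_le_sq_mul_sq s (fun i => √(w i) * √(x i)) (fun i => √(w i) * √(y i))
    have e1 : ∑ i ∈ s, √(w i) * √(x i) * (√(w i) * √(y i)) = ∑ i ∈ s, w i * (√(x i) * √(y i)) :=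
      Finset.sum_congr rfl fun i hi => by
        linear_combination (√(x i) * √(y i)) * Real.mul_self_sqrt (hw i hi)
    have e2 : ∀ u : ι → ℝ, (∀ i, 0 ≤ u i) →
        ∑ i ∈ s, (√(w i) * √(u i)) ^ 2 = ∑ i ∈ s, w i * u i := fun u hu =>
      Finset.sum_congr rfl fun i hi => by
        rw [mul_pow, Real.sq_sqrt (hw i hi), Real.sq_sqrt (hu i)]
    rw [e1, e2 x hx, e2 y hy] at h
    rw [← Real.sqrt_mul hX]
    exact Real.le_sqrt_of_sq_le h
  have e : ∑ i ∈ s, w i * (√(x i) - √(y i)) ^ 2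
      = ∑ i ∈ s, w i * x i + ∑ i ∈ s, w i * y i - 2 * ∑ i ∈ s, w i * (√(x i) * √(y i)) := by
    rw [Finset.mul_sum, ← Finset.sum_add_distrib, ← Finset.sum_sub_distrib]
    refine Finset.sum_congr rfl fun i _ => ?_
    linear_combination w i * Real.sq_sqrt (hx i) + w i * Real.sq_sqrt (hy i)
  rw [e]
  nlinarith [Real.sq_sqrt hX, Real.sq_sqrt hY]

/-- Gibbs' inequality against a subprobability with weights `exp (-len)`. -/
theorem sum_neg_mul_log_le {V : Type*} [Fintype V] {p len : V → ℝ} (hp : ∀ v, 0 ≤ p v)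
    (h1 : ∑ v, p v = 1) (hlen : ∑ v, Real.exp (-len v) ≤ 1) :
    -∑ v, p v * Real.log (p v) ≤ ∑ v, p v * len v := by
  have h : ∀ v, p v - Real.exp (-len v) ≤ p v * Real.log (p v) + p v * len v := by
    intro v
    rcases (hp v).eq_or_lt with h0 | h0
    · rw [← h0]; simpa using (Real.exp_pos _).le
    · have := Real.log_le_sub_one_of_pos (div_pos (Real.exp_pos (-len v)) h0)
      rw [Real.log_div (Real.exp_pos _).ne' h0.ne', Real.log_exp] at this
      have := mul_le_mul_of_nonneg_left this h0.le
      have e : p v * (Real.exp (-len v) / p v - 1) = Real.exp (-len v) - p v := by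
        field_simp
      rw [e] at this
      linarith
  have := Finset.sum_le_sum fun v (_ : v ∈ Finset.univ) => h v
  rw [Finset.sum_sub_distrib, Finset.sum_add_distrib] at this
  linarith

/-! ### Weighted sums with product weights -/

section ProdSum

variable {B E F : Type*} [Fintype B] [DecidableEq B] [Fintype E] [Fintype F]

/-- The sum of `g` over all configurations, with product weights `ω`. -/
noncomputable def prodSum (ω : B → E → ℝ) (g : (B → E) → ℝ) : ℝ :=
  ∑ e : B → E, (∏ b, ω b (e b)) * g e

/-- The point mass at `a`. -/
def pointMass [DecidableEq E] (a a' : E) : ℝ := if a' = a then 1 else 0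

theorem sum_pointMass [DecidableEq E] (a : E) : ∑ a', pointMass a a' = 1 := by
  simp [pointMass]

omit [Fintype E] in
theorem pointMass_nonneg [DecidableEq E] (a a' : E) : 0 ≤ pointMass a a' := by
  unfold pointMass; split_ifs <;> norm_num

theorem prodSum_pointMass [DecidableEq E] (e : B → E) (g : (B → E) → ℝ) :
    prodSum (fun b => pointMass (e b)) g = g e := by
  unfold prodSum pointMass
  have h : ∀ e' : B → E, (∀ b, e' b = e b) ↔ e' = e := fun e' => funext_iff.symm
  simp [Finset.prod_boole, h]

/-- Composing product kernels is done coordinate by coordinate. Operator identities below thereby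
reduce to a check on a single column. -/
theorem prodSum_bind {ω : B → E → ℝ} {K : B → E → F → ℝ} {g : (B → F) → ℝ} :
    prodSum ω (fun e => prodSum (fun b => K b (e b)) g)
      = prodSum (fun b a' => ∑ a, ω b a * K b a a') g := by
  unfold prodSum
  simp_rw [Finset.prod_univ_sum, Finset.mul_sum, Fintype.piFinset_univ]
  rw [Finset.sum_comm]
  refine Finset.sum_congr rfl fun e' _ => ?_
  rw [Finset.sum_mul]
  refine Finset.sum_congr rfl fun e _ => ?_
  rw [Finset.prod_mul_distrib, mul_assoc]

theorem prodSum_pair {ω : B → E → ℝ} {K : B → E → F → ℝ} {g : (B → E) → (B → F) → ℝ} :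
    prodSum ω (fun e => prodSum (fun b => K b (e b)) (g e))
      = prodSum (fun b (p : E × F) => ω b p.1 * K b p.1 p.2)
          (fun p => g (fun b => (p b).1) (fun b => (p b).2)) := by
  unfold prodSum
  rw [← (Equiv.arrowProdEquivProdArrow B (fun _ => E) (fun _ => F)).symm.sum_comp, Fintype.sum_prod_type]
  refine Finset.sum_congr rfl fun e _ => ?_
  rw [Finset.mul_sum]
  refine Finset.sum_congr rfl fun e' _ => ?_
  simp [Equiv.arrowProdEquivProdArrow, Finset.prod_mul_distrib, mul_assoc]

theorem prodSum_mono {ω : B → E → ℝ} (hω : ∀ b a, 0 ≤ ω b a) {g h : (B → E) → ℝ}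
    (hgh : ∀ e, g e ≤ h e) : prodSum ω g ≤ prodSum ω h :=
  Finset.sum_le_sum fun e _ =>
    mul_le_mul_of_nonneg_left (hgh e) (Finset.prod_nonneg fun b _ => hω b _)

theorem prodSum_const {ω : B → E → ℝ} (hω : ∀ b, ∑ a, ω b a = 1) (c : ℝ) :
    prodSum ω (fun _ => c) = c := by
  unfold prodSum
  rw [← Finset.sum_mul]
  have := Finset.prod_univ_sum (fun _ : B => (Finset.univ : Finset E)) ω
  rw [Fintype.piFinset_univ] at this
  rw [← this, Finset.prod_congr rfl fun b _ => hω b]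
  simp

theorem prodSum_nonneg {ω : B → E → ℝ} (hω : ∀ b a, 0 ≤ ω b a) {g : (B → E) → ℝ}
    (hg : ∀ e, 0 ≤ g e) : 0 ≤ prodSum ω g :=
  Finset.sum_nonneg fun e _ => mul_nonneg (Finset.prod_nonneg fun b _ => hω b _) (hg e)

theorem prodSum_add (ω : B → E → ℝ) (g h : (B → E) → ℝ) :
    prodSum ω (fun e => g e + h e) = prodSum ω g + prodSum ω h := by
  simp [prodSum, mul_add, Finset.sum_add_distrib]

theorem prodSum_sub (ω : B → E → ℝ) (g h : (B → E) → ℝ) :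
    prodSum ω (fun e => g e - h e) = prodSum ω g - prodSum ω h := by
  simp [prodSum, mul_sub, Finset.sum_sub_distrib]

theorem prodSum_sum {ι : Type*} (s : Finset ι) (ω : B → E → ℝ) (g : ι → (B → E) → ℝ) :
    prodSum ω (fun e => ∑ i ∈ s, g i e) = ∑ i ∈ s, prodSum ω (g i) := by
  unfold prodSum
  simp_rw [Finset.mul_sum]
  exact Finset.sum_comm

theorem prodSum_const_mul (ω : B → E → ℝ) (c : ℝ) (g : (B → E) → ℝ) :
    prodSum ω (fun e => c * g e) = c * prodSum ω g := by
  unfold prodSum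
  rw [Finset.mul_sum]
  exact Finset.sum_congr rfl fun e _ => by ring

theorem prodSum_mul_const (ω : B → E → ℝ) (c : ℝ) (g : (B → E) → ℝ) :
    prodSum ω (fun e => g e * c) = prodSum ω g * c := by
  simp_rw [mul_comm _ c]
  exact prodSum_const_mul ω c g

theorem prodSum_congr_of_ne_zero {ω : B → E → ℝ} {g h : (B → E) → ℝ}
    (hgh : ∀ e, (∀ b, ω b (e b) ≠ 0) → g e = h e) : prodSum ω g = prodSum ω h := by
  refine Finset.sum_congr rfl fun e _ => ?_
  by_cases h0 : ∏ b, ω b (e b) = 0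
  · rw [h0, zero_mul, zero_mul]
  · rw [hgh e fun b => Finset.prod_ne_zero_iff.1 h0 b (Finset.mem_univ b)]

/-- The product weight is linear in the law of each coordinate, and every law is a mixture of point
masses. -/
theorem prodSum_update_linear (ω : B → E → ℝ) (b : B) (θ : E → ℝ) (g : (B → E) → ℝ)
    [DecidableEq E] :
    prodSum (Function.update ω b θ) g
      = ∑ a, θ a * prodSum (Function.update ω b (pointMass a)) g := by
  unfold prodSum
  simp_rw [Finset.mul_sum]
  rw [Finset.sum_comm]
  refine Finset.sum_congr rfl fun e _ => ?_
  have h : ∀ η : E → ℝ, ∏ b', Function.update ω b η b' (e b')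
      = η (e b) * ∏ b' ∈ Finset.univ.erase b, ω b' (e b') := by
    intro η
    rw [← Finset.mul_prod_erase _ _ (Finset.mem_univ b), Function.update_self]
    congr 1
    refine Finset.prod_congr rfl fun b' hb' => ?_
    rw [Function.update_of_ne (Finset.ne_of_mem_erase hb')]
  simp_rw [h, pointMass]
  simp [mul_assoc]

theorem prodSum_comp_update [DecidableEq E] (ω : B → E → ℝ) (b : B) (hω : ∑ a, ω b a = 1) (a : E)
    (g : (B → E) → ℝ) :
    prodSum ω (fun e => g (Function.update e b a))
      = prodSum (Function.update ω b (pointMass a)) g := by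
  have h : ∀ e : B → E, g (Function.update e b a)
      = prodSum (fun b' => (if b' = b then fun _ => pointMass a else pointMass) (e b')) g := by
    intro e
    rw [← prodSum_pointMass (Function.update e b a) g]
    congr 1
    funext b'
    by_cases hb : b' = b
    · subst hb; simp
    · simp [hb]
  simp_rw [h]
  rw [prodSum_bind]
  congr 1
  funext b' a'
  by_cases hb : b' = b
  · subst hb; simp [← Finset.sum_mul, hω]
  · simp [hb, pointMass]

/-- Resampling one coordinate. -/
theorem prodSum_resample [DecidableEq E] (ω : B → E → ℝ) (b : B) (hω : ∑ a, ω b a = 1)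
    (g : (B → E) → ℝ) :
    prodSum ω g = prodSum ω (fun e => ∑ a, ω b a * g (Function.update e b a)) := by
  rw [prodSum_sum]
  simp_rw [prodSum_const_mul, prodSum_comp_update ω b hω]
  rw [← prodSum_update_linear, Function.update_eq_self]

theorem prodSum_update_of_insensitive [DecidableEq E] (ω : B → E → ℝ) (b : B) (θ : E → ℝ)
    (hω : ∑ a, ω b a = 1) (hθ : ∑ a, θ a = 1) (g : (B → E) → ℝ)
    (hg : ∀ e a, g (Function.update e b a) = g e) :
    prodSum (Function.update ω b θ) g = prodSum ω g := by
  rw [prodSum_update_linear]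
  simp_rw [← prodSum_comp_update ω b hω, hg]
  rw [← Finset.sum_mul, hθ, one_mul]

theorem prodSum_factor (ω₁ : B → E → ℝ) (ω₂ : B → F → ℝ) (g : (B → E) → ℝ) (h : (B → F) → ℝ) :
    prodSum (fun b (p : E × F) => ω₁ b p.1 * ω₂ b p.2)
        (fun p => g (fun b => (p b).1) * h (fun b => (p b).2))
      = prodSum ω₁ g * prodSum ω₂ h := by
  have := prodSum_pair (ω := ω₁) (K := fun b _ => ω₂ b) (g := fun e f => g e * h f)
  rw [← this]
  simp_rw [prodSum_const_mul]
  rw [prodSum_mul_const]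

end ProdSum

/-! ### The column law and its resampling operators -/

/-- A bit as a real number. -/
def bitReal (x : Bool) : ℝ := if x then 1 else 0

/-- The Bernoulli law with parameter `p`. -/
noncomputable def bern (p : ℝ) (x : Bool) : ℝ := if x then p else 1 - p

/-- The law of the mode bit of a column. -/
noncomputable def modeLaw (m : Bool) : ℝ := if m then 1 / 3 else 2 / 3

/-- The probability of a one in a cell of a given kind (`some x` for a cell frozen to `x`,
`none` for a free cell), given the mode of its column. -/
noncomputable def cellBias (κ : Option Bool) (m : Bool) : ℝ :=
  match κ with
  | some x => bitReal x
  | none => if m then 1 else 1 / 2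

/-- The law of the mode of a column given the content of one cell. -/
noncomputable def modePost (κ : Option Bool) (x m : Bool) : ℝ :=
  match κ with
  | some _ => modeLaw m
  | none => if x then 1 / 2 else if m then 0 else 1

/-- The joint law of the mode of a column and the content of one cell. -/
noncomputable def cellLaw (κ : Option Bool) (a : Bool × Bool) : ℝ :=
  modeLaw a.1 * bern (cellBias κ a.1) a.2

theorem bitReal_mem (x : Bool) : 0 ≤ bitReal x ∧ bitReal x ≤ 1 := by
  cases x <;> simp [bitReal]

theorem cellBias_mem (κ : Option Bool) (m : Bool) : 0 ≤ cellBias κ m ∧ cellBias κ m ≤ 1 := by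
  rcases κ with _ | x
  · cases m <;> norm_num [cellBias]
  · exact bitReal_mem x

theorem bern_nonneg {p : ℝ} (hp : 0 ≤ p ∧ p ≤ 1) (x : Bool) : 0 ≤ bern p x := by
  cases x <;> simp [bern, hp.1, hp.2]

theorem sum_bern (p : ℝ) : ∑ x, bern p x = 1 := by simp [bern]

theorem bern_bitReal (x : Bool) : bern (bitReal x) = pointMass x := by
  funext y; cases x <;> cases y <;> simp [bern, bitReal, pointMass]

theorem modeLaw_nonneg (m : Bool) : 0 ≤ modeLaw m := by cases m <;> norm_num [modeLaw]

theorem sum_modeLaw : ∑ m, modeLaw m = 1 := by simp [modeLaw]; norm_num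

theorem modePost_nonneg (κ : Option Bool) (x m : Bool) : 0 ≤ modePost κ x m := by
  rcases κ with _ | y
  · cases x <;> cases m <;> norm_num [modePost]
  · exact modeLaw_nonneg m

theorem sum_modePost (κ : Option Bool) (x : Bool) : ∑ m, modePost κ x m = 1 := by
  rcases κ with _ | y
  · cases x <;> norm_num [modePost]
  · exact sum_modeLaw

theorem cellLaw_nonneg (κ : Option Bool) (a : Bool × Bool) : 0 ≤ cellLaw κ a :=
  mul_nonneg (modeLaw_nonneg _) (bern_nonneg (cellBias_mem _ _) _)

theorem sum_cellLaw (κ : Option Bool) : ∑ a, cellLaw κ a = 1 := by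
  simp only [Fintype.sum_prod_type, cellLaw, ← Finset.mul_sum, sum_bern, mul_one, sum_modeLaw]

/-- Bayes' rule. A free cell is one with probability 1/3 + 2/3 · 1/2, so a one leaves the mode
balanced, while a zero forces mode `false`. -/
theorem sum_cellLaw_mul_modePost (κ : Option Bool) (x m : Bool) :
    ∑ m', cellLaw κ (m', x) * modePost κ x m = cellLaw κ (m, x) := by
  rcases κ with _ | y
  · cases x <;> cases m <;> norm_num [cellLaw, modePost, modeLaw, bern, cellBias]
  · cases x <;> cases m <;> cases y <;>
      norm_num [cellLaw, modePost, modeLaw, bern, cellBias, bitReal]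

section Resample

variable {B : Type*} [Fintype B] [DecidableEq B] (κ : B → Option Bool)

/-- One coordinate of the kernel which resamples the cell given the mode on `S`, and the mode
given the cell on `L`. -/
noncomputable def resampleKernel (S L : Finset B) (b : B) (a a' : Bool × Bool) : ℝ :=
  (if b ∈ L then modePost (κ b) a.2 else pointMass a.1) a'.1 *
    (if b ∈ S then bern (cellBias (κ b) a.1) else pointMass a.2) a'.2

/-- Resample the cells in `S` given the modes, and the modes in `L` given the cells. -/
noncomputable def resample (S L : Finset B) (f : (B → Bool × Bool) → ℝ) (e : B → Bool × Bool) : ℝ :=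
  prodSum (fun b => resampleKernel κ S L b (e b)) f

/-- The expectation over the modes of all columns and the cells of one row. -/
noncomputable def rowExp (f : (B → Bool × Bool) → ℝ) : ℝ := prodSum (fun b => cellLaw (κ b)) f

variable {κ}

omit [Fintype B] in
theorem resampleKernel_nonneg (S L : Finset B) (b : B) (a a' : Bool × Bool) :
    0 ≤ resampleKernel κ S L b a a' := by
  unfold resampleKernel
  refine mul_nonneg ?_ ?_ <;> split_ifs
  · exact modePost_nonneg _ _ _
  · exact pointMass_nonneg _ _
  · exact bern_nonneg (cellBias_mem _ _) _
  · exact pointMass_nonneg _ _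

omit [Fintype B] in
theorem sum_resampleKernel (S L : Finset B) (b : B) (a : Bool × Bool) :
    ∑ a', resampleKernel κ S L b a a' = 1 := by
  unfold resampleKernel
  simp only [Fintype.sum_prod_type, ← Finset.mul_sum]
  have h2 : ∑ x, (if b ∈ S then bern (cellBias (κ b) a.1) else pointMass a.2) x = 1 := by
    split_ifs
    exacts [sum_bern _, sum_pointMass _]
  simp only [h2, mul_one]
  split_ifs
  exacts [sum_modePost _ _, sum_pointMass _]

theorem resample_nonneg {S L : Finset B} {f : (B → Bool × Bool) → ℝ} (hf : ∀ e, 0 ≤ f e)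
    (e : B → Bool × Bool) : 0 ≤ resample κ S L f e :=
  prodSum_nonneg (fun b a => resampleKernel_nonneg S L b (e b) a) hf

theorem sum_resample {V : Type*} [Fintype V] {S L : Finset B} {f : V → (B → Bool × Bool) → ℝ}
    (hf : ∀ e, ∑ v, f v e = 1) (e : B → Bool × Bool) : ∑ v, resample κ S L (f v) e = 1 := by
  unfold resample
  rw [← prodSum_sum]
  simp_rw [hf]
  exact prodSum_const (fun b => sum_resampleKernel S L b (e b)) 1

/-- No column is resampled twice when `S` and `L` are disjoint, so the order of the two resamplings
is immaterial. This lets estimates from the two chains be brought to the same averaged densities. -/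
theorem resample_mode_cell {S L : Finset B} (h : Disjoint S L) (f : (B → Bool × Bool) → ℝ)
    (e : B → Bool × Bool) : resample κ ∅ L (resample κ S ∅ f) e = resample κ S L f e := by
  unfold resample
  rw [prodSum_bind]
  congr 1
  funext b a'
  rcases e b with ⟨m, x⟩
  rcases a' with ⟨m', x'⟩
  by_cases hS : b ∈ S
  · have hL : b ∉ L := Finset.disjoint_left.1 h hS
    simp [resampleKernel, hS, hL, Fintype.sum_prod_type, pointMass, eq_comm]
    cases m <;> cases m' <;> simp
  · simp [resampleKernel, hS, Fintype.sum_prod_type, pointMass, eq_comm]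

theorem resample_cell_mode {S L : Finset B} (h : Disjoint S L) (f : (B → Bool × Bool) → ℝ)
    (e : B → Bool × Bool) : resample κ S ∅ (resample κ ∅ L f) e = resample κ S L f e := by
  unfold resample
  rw [prodSum_bind]
  congr 1
  funext b a'
  rcases e b with ⟨m, x⟩
  rcases a' with ⟨m', x'⟩
  by_cases hS : b ∈ S
  · have hL : b ∉ L := Finset.disjoint_left.1 h hS
    simp [resampleKernel, hS, hL, Fintype.sum_prod_type, pointMass, eq_comm]
  · simp [resampleKernel, hS, Fintype.sum_prod_type, pointMass, eq_comm]
    cases m <;> cases x <;> cases m' <;> cases x' <;> simp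

/-- Resampling from a conditional law leaves the joint law of mode and cell invariant. -/
theorem rowExp_resample_cell (S : Finset B) (f : (B → Bool × Bool) → ℝ) :
    rowExp κ (resample κ S ∅ f) = rowExp κ f := by
  unfold rowExp resample
  rw [prodSum_bind]
  congr 1
  funext b a'
  rcases a' with ⟨m', x'⟩
  by_cases hS : b ∈ S
  · simp only [resampleKernel, hS, Fintype.sum_prod_type, pointMass, if_true, Finset.notMem_empty,
      if_false, cellLaw]
    have : bern (cellBias (κ b) m') true + bern (cellBias (κ b) m') false = 1 := by simp [bern]
    cases m' <;> simp <;> linear_combination (modeLaw _ * bern (cellBias (κ b) _) x') * this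
  · simp only [resampleKernel, hS, Fintype.sum_prod_type, pointMass, Finset.notMem_empty,
      if_false, cellLaw]
    cases m' <;> cases x' <;> simp

theorem rowExp_resample_mode (L : Finset B) (f : (B → Bool × Bool) → ℝ) :
    rowExp κ (resample κ ∅ L f) = rowExp κ f := by
  unfold rowExp resample
  rw [prodSum_bind]
  congr 1
  funext b a'
  rcases a' with ⟨m', x'⟩
  by_cases hL : b ∈ L
  · rw [← sum_cellLaw_mul_modePost]
    simp only [resampleKernel, hL, Fintype.sum_prod_type, pointMass, if_true, Finset.notMem_empty,
      if_false]
    cases x' <;> simp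
  · simp only [resampleKernel, hL, Fintype.sum_prod_type, pointMass, Finset.notMem_empty,
      if_false, cellLaw]
    cases m' <;> cases x' <;> simp

theorem resample_update_of_notMem {S L : Finset B} {b : B} (hS : b ∉ S) (hL : b ∉ L)
    (f : (B → Bool × Bool) → ℝ) (e : B → Bool × Bool) (a : Bool × Bool) :
    resample κ S L f (Function.update e b a)
      = prodSum (Function.update (fun b' => resampleKernel κ S L b' (e b')) b (pointMass a)) f := by
  unfold resample
  congr 1
  funext b' a'
  by_cases h : b' = b
  · subst h
    rcases a with ⟨m, x⟩
    rcases a' with ⟨m', x'⟩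
    simp only [Function.update_self, resampleKernel, hS, hL, if_false, pointMass]
    cases m <;> cases x <;> cases m' <;> cases x' <;> simp
  · simp [h]

theorem resample_update_comm {S L : Finset B} {b : B} (hS : b ∉ S) (hL : b ∉ L)
    (f : (B → Bool × Bool) → ℝ) (e : B → Bool × Bool) (a : Bool × Bool) :
    resample κ S L f (Function.update e b a)
      = resample κ S L (fun e' => f (Function.update e' b a)) e := by
  rw [resample_update_of_notMem hS hL]
  exact (prodSum_comp_update (fun b => resampleKernel κ S L b (e b)) b
    (sum_resampleKernel S L b (e b)) a f).symm

theorem resample_insert_cell {S : Finset B} {b : B} (hS : b ∉ S) (f : (B → Bool × Bool) → ℝ)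
    (e : B → Bool × Bool) :
    resample κ (insert b S) ∅ f e = ∑ x, bern (cellBias (κ b) (e b).1) x *
      resample κ S ∅ f (Function.update e b ((e b).1, x)) := by
  have h : resample κ (insert b S) ∅ f e
      = prodSum (Function.update (fun b' => resampleKernel κ S ∅ b' (e b')) b
          (resampleKernel κ (insert b S) ∅ b (e b))) f := by
    unfold resample
    congr 1
    funext b'
    by_cases h : b' = b
    · subst h; simp
    · funext a'
      simp [h, resampleKernel]
  rw [h, prodSum_update_linear]
  simp_rw [← resample_update_of_notMem hS (Finset.notMem_empty b)]
  rw [Fintype.sum_prod_type]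
  simp only [resampleKernel, Finset.mem_insert_self, if_true, Finset.notMem_empty, if_false]
  cases (e b).1 <;> simp [pointMass]

theorem resample_insert_mode {L : Finset B} {b : B} (hL : b ∉ L) (f : (B → Bool × Bool) → ℝ)
    (e : B → Bool × Bool) :
    resample κ ∅ (insert b L) f e = ∑ m, modePost (κ b) (e b).2 m *
      resample κ ∅ L f (Function.update e b (m, (e b).2)) := by
  have h : resample κ ∅ (insert b L) f e
      = prodSum (Function.update (fun b' => resampleKernel κ ∅ L b' (e b')) b
          (resampleKernel κ ∅ (insert b L) b (e b))) f := by
    unfold resample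
    congr 1
    funext b'
    by_cases h : b' = b
    · subst h; simp
    · funext a'
      simp [h, resampleKernel]
  rw [h, prodSum_update_linear]
  simp_rw [← resample_update_of_notMem (Finset.notMem_empty b) hL]
  rw [Fintype.sum_prod_type]
  simp only [resampleKernel, Finset.mem_insert_self, if_true, Finset.notMem_empty, if_false]
  cases (e b).2 <;> simp [pointMass]

theorem rowExp_mono {f g : (B → Bool × Bool) → ℝ} (h : ∀ e, f e ≤ g e) : rowExp κ f ≤ rowExp κ g :=
  prodSum_mono (fun _ _ => cellLaw_nonneg _ _) h

theorem rowExp_nonneg {f : (B → Bool × Bool) → ℝ} (h : ∀ e, 0 ≤ f e) : 0 ≤ rowExp κ f :=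
  prodSum_nonneg (fun _ _ => cellLaw_nonneg _ _) h

theorem rowExp_resample_coord (b : B) (f : (B → Bool × Bool) → ℝ) :
    rowExp κ f = rowExp κ (fun e => ∑ a, cellLaw (κ b) a * f (Function.update e b a)) :=
  prodSum_resample _ b (sum_cellLaw _) f

end Resample

/-! ### Squared Hellinger distance -/

section Hellinger

variable {Ω : Type*} [Fintype Ω]

/-- Twice the squared Hellinger distance of two densities on a finite set. -/
noncomputable def hellSq (f g : Ω → ℝ) : ℝ := ∑ v, (√(f v) - √(g v)) ^ 2

theorem hellSq_nonneg (f g : Ω → ℝ) : 0 ≤ hellSq f g := Finset.sum_nonneg fun _ _ => sq_nonneg _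

theorem hellSq_comm (f g : Ω → ℝ) : hellSq f g = hellSq g f :=
  Finset.sum_congr rfl fun _ _ => by ring

theorem hellSq_triangle (f g h : Ω → ℝ) : hellSq f h ≤ 2 * hellSq f g + 2 * hellSq g h := by
  unfold hellSq
  rw [Finset.mul_sum, Finset.mul_sum, ← Finset.sum_add_distrib]
  refine Finset.sum_le_sum fun v _ => ?_
  nlinarith [sq_nonneg (√(f v) - √(g v) - (√(g v) - √(h v)))]

/-- Cut and paste: the Hellinger distance of two densities of mass one only depends on their
product. -/
theorem hellSq_eq_of_mul_eq {f g f' g' : Ω → ℝ} (hf : ∀ v, 0 ≤ f v) (hg : ∀ v, 0 ≤ g v)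
    (hf' : ∀ v, 0 ≤ f' v) (hg' : ∀ v, 0 ≤ g' v) (sf : ∑ v, f v = 1) (sg : ∑ v, g v = 1)
    (sf' : ∑ v, f' v = 1) (sg' : ∑ v, g' v = 1) (h : ∀ v, f v * g v = f' v * g' v) :
    hellSq f g = hellSq f' g' := by
  have key : ∀ {f g : Ω → ℝ}, (∀ v, 0 ≤ f v) → (∀ v, 0 ≤ g v) → ∑ v, f v = 1 → ∑ v, g v = 1 →
      hellSq f g = 2 - 2 * ∑ v, √(f v * g v) := by
    intro f g hf hg sf sg
    have : 2 - 2 * ∑ v, √(f v * g v) = ∑ v, f v + ∑ v, g v - 2 * ∑ v, √(f v * g v) := by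
      rw [sf, sg]; norm_num
    rw [hellSq, this, Finset.mul_sum, ← Finset.sum_add_distrib, ← Finset.sum_sub_distrib]
    refine Finset.sum_congr rfl fun v _ => ?_
    rw [Real.sqrt_mul (hf v)]
    nlinarith [Real.sq_sqrt (hf v), Real.sq_sqrt (hg v)]
  rw [key hf hg sf sg, key hf' hg' sf' sg']
  simp_rw [h]

/-- If three corners of a rectangle of product densities are close, then so is the fourth. -/
theorem hellSq_fourth_corner {α β : Bool → Ω → ℝ} (hα : ∀ s v, 0 ≤ α s v) (hβ : ∀ m v, 0 ≤ β m v)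
    (h1 : ∀ m s, ∑ v, β m v * α s v = 1) :
    hellSq (fun v => β true v * α false v) (fun v => β true v * α true v)
      ≤ 4 * hellSq (fun v => β false v * α false v) (fun v => β false v * α true v)
        + 6 * hellSq (fun v => β false v * α true v) (fun v => β true v * α true v) := by
  have hn : ∀ m s v, 0 ≤ β m v * α s v := fun m s v => mul_nonneg (hβ m v) (hα s v)
  -- Both diagonals of the rectangle have the product `β₀ β₁ α₀ α₁`, hence the same length.
  have e : hellSq (fun v => β true v * α false v) (fun v => β false v * α true v)
      = hellSq (fun v => β false v * α false v) (fun v => β true v * α true v) :=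
    hellSq_eq_of_mul_eq (hn _ _) (hn _ _) (hn _ _) (hn _ _) (h1 _ _) (h1 _ _) (h1 _ _) (h1 _ _)
      fun v => by ring
  have t1 := hellSq_triangle (fun v => β true v * α false v) (fun v => β false v * α true v)
    (fun v => β true v * α true v)
  have t2 := hellSq_triangle (fun v => β false v * α false v) (fun v => β false v * α true v)
    (fun v => β true v * α true v)
  linarith

end Hellinger

/-! ### Information revealed along a chain of columns -/

section Chain

variable {B : Type*} [Fintype B] [DecidableEq B] {N : ℕ}

/-- The columns before `b` in the order `σ`. -/
def earlier (σ : B ≃ Fin N) (b : B) : Finset B := Finset.univ.filter fun b' => σ b' < σ b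

/-- The columns after `b` in the order `σ`. -/
def later (σ : B ≃ Fin N) (b : B) : Finset B := Finset.univ.filter fun b' => σ b < σ b'

/-- Telescoping of the potential `Φ` as the columns are added in the order `σ`. -/
theorem sum_chain_le (σ : B ≃ Fin N) (Φ : Finset B → ℝ) (gain : Finset B → B → ℝ)
    (h : ∀ S b, b ∉ S → gain S b ≤ Φ S - Φ (insert b S)) :
    ∑ b, gain (earlier σ b) b ≤ Φ ∅ - Φ Finset.univ := by
  let S : ℕ → Finset B := fun t => Finset.univ.filter fun b' => (σ b' : ℕ) < t
  have h0 : S 0 = ∅ := by simp [S]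
  have hN : S N = Finset.univ := by simp [S]
  have hstep : ∀ b, insert b (earlier σ b) = S ((σ b : ℕ) + 1) := by
    intro b
    ext b'
    simp only [earlier, S, Finset.mem_insert, Finset.mem_filter, Finset.mem_univ, true_and,
      Nat.lt_succ_iff_lt_or_eq, Fin.lt_def]
    rw [← Fin.ext_iff, σ.injective.eq_iff, or_comm]
  have hS : ∀ b, earlier σ b = S (σ b : ℕ) := fun b => by
    ext b'; simp [earlier, S]
  calc ∑ b, gain (earlier σ b) b
      ≤ ∑ b, (Φ (S (σ b : ℕ)) - Φ (S ((σ b : ℕ) + 1))) := by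
        refine Finset.sum_le_sum fun b _ => ?_
        rw [← hstep, ← hS]
        exact h _ _ (by simp [earlier])
    _ = ∑ t : Fin N, (Φ (S (t : ℕ)) - Φ (S ((t : ℕ) + 1))) :=
        σ.sum_comp fun t : Fin N => Φ (S (t : ℕ)) - Φ (S ((t : ℕ) + 1))
    _ = Φ ∅ - Φ Finset.univ := by
        rw [Fin.sum_univ_eq_sum_range fun t => Φ (S t) - Φ (S (t + 1)),
          Finset.sum_range_sub', h0, hN]

/-- The same chain for the reversed order: the columns already processed before `b` are those after
it in `σ`. -/
theorem sum_chain_le' (σ : B ≃ Fin N) (Φ : Finset B → ℝ) (gain : Finset B → B → ℝ)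
    (h : ∀ S b, b ∉ S → gain S b ≤ Φ S - Φ (insert b S)) :
    ∑ b, gain (later σ b) b ≤ Φ ∅ - Φ Finset.univ := by
  have := sum_chain_le (σ.trans Fin.revPerm) Φ gain h
  have e : ∀ b, earlier (σ.trans Fin.revPerm) b = later σ b := fun b => by
    ext b'; simp [earlier, later]
  simpa only [e] using this

variable {κ : B → Option Bool}

/-- Averaging over the cell given its mode lowers the expectation of `f log f` by a Jensen gap,
bounded below by `mul_log_gap`. At a free cell only mode `false` contributes, with weight 2/3 · 1/2
· 1/2 = 1/6. -/
theorem cell_step {S : Finset B} {b : B} (hS : b ∉ S) {f : (B → Bool × Bool) → ℝ}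
    (hf : ∀ e, 0 ≤ f e) :
    (if κ b = none then rowExp κ (fun e => 1 / 6 *
        (√(resample κ S ∅ f (Function.update e b (false, false)))
          - √(resample κ S ∅ f (Function.update e b (false, true)))) ^ 2) else 0)
      ≤ rowExp κ (fun e => resample κ S ∅ f e * Real.log (resample κ S ∅ f e))
        - rowExp κ (fun e => resample κ (insert b S) ∅ f e
            * Real.log (resample κ (insert b S) ∅ f e)) := by
  have hg : ∀ e, 0 ≤ resample κ S ∅ f e := resample_nonneg hf
  set g := resample κ S ∅ f
  simp_rw [resample_insert_cell hS]
  rw [rowExp_resample_coord b (fun e => g e * Real.log (g e)), rowExp_resample_coord b (fun e =>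
    (∑ x, bern (cellBias (κ b) (e b).1) x * g (Function.update e b ((e b).1, x))) *
      Real.log (∑ x, bern (cellBias (κ b) (e b).1) x * g (Function.update e b ((e b).1, x))))]
  unfold rowExp
  rw [← prodSum_sub]
  have key : ∀ (m : Bool) (e : B → Bool × Bool),
      cellBias (κ b) m * (1 - cellBias (κ b) m) *
        (√(g (Function.update e b (m, false))) - √(g (Function.update e b (m, true)))) ^ 2 ≤ _ :=
    fun m e => mul_log_gap (cellBias_mem (κ b) m).1 (cellBias_mem (κ b) m).2
      (hg (Function.update e b (m, false))) (hg (Function.update e b (m, true)))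
  have hm : ∀ m, 0 ≤ modeLaw m := modeLaw_nonneg
  have hgap : ∀ e : B → Bool × Bool, ∑ m, modeLaw m * (cellBias (κ b) m * (1 - cellBias (κ b) m) *
      (√(g (Function.update e b (m, false))) - √(g (Function.update e b (m, true)))) ^ 2) ≤
      ∑ a, cellLaw (κ b) a * (g (Function.update e b a) * Real.log (g (Function.update e b a))) -
      ∑ a, cellLaw (κ b) a * ((∑ x, bern (cellBias (κ b) (Function.update e b a b).1) x *
          g (Function.update (Function.update e b a) b ((Function.update e b a b).1, x))) *
        Real.log (∑ x, bern (cellBias (κ b) (Function.update e b a b).1) x *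
          g (Function.update (Function.update e b a) b ((Function.update e b a b).1, x)))) := by
    intro e
    rw [← Finset.sum_sub_distrib, Fintype.sum_prod_type]
    refine Finset.sum_le_sum fun m _ => ?_
    refine (mul_le_mul_of_nonneg_left (key m e) (hm m)).trans (le_of_eq ?_)
    simp only [Function.update_self, Function.update_idem, cellLaw, Fintype.sum_bool, bern,
      if_true, Bool.false_eq_true, if_false]
    rw [add_comm (cellBias (κ b) m * _)]
    ring
  split_ifs with hk
  · refine prodSum_mono (fun _ _ => cellLaw_nonneg _ _) fun e => le_trans ?_ (hgap e)
    simp only [hk, cellBias, Fintype.sum_bool, modeLaw]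
    norm_num
    rw [← mul_assoc]
    norm_num
  · refine prodSum_nonneg (fun _ _ => cellLaw_nonneg _ _) fun e => le_trans ?_ (hgap e)
    refine Finset.sum_nonneg fun m _ => mul_nonneg (hm m) (mul_nonneg (mul_nonneg
      (cellBias_mem _ _).1 (by linarith [(cellBias_mem (κ b) m).2])) (sq_nonneg _))

/-- The counterpart of `cell_step` given the content of the cell. Content one has probability 2/3
and leaves the mode balanced, which gives 2/3 · 1/2 · 1/2 = 1/6; content zero determines the mode.
-/
theorem mode_step {L : Finset B} {b : B} (hL : b ∉ L) {f : (B → Bool × Bool) → ℝ}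
    (hf : ∀ e, 0 ≤ f e) :
    (if κ b = none then rowExp κ (fun e => 1 / 6 *
        (√(resample κ ∅ L f (Function.update e b (false, true)))
          - √(resample κ ∅ L f (Function.update e b (true, true)))) ^ 2) else 0)
      ≤ rowExp κ (fun e => resample κ ∅ L f e * Real.log (resample κ ∅ L f e))
        - rowExp κ (fun e => resample κ ∅ (insert b L) f e
            * Real.log (resample κ ∅ (insert b L) f e)) := by
  have hg : ∀ e, 0 ≤ resample κ ∅ L f e := resample_nonneg hf
  set g := resample κ ∅ L f
  simp_rw [resample_insert_mode hL]
  rw [rowExp_resample_coord b (fun e => g e * Real.log (g e)), rowExp_resample_coord b (fun e =>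
    (∑ m, modePost (κ b) (e b).2 m * g (Function.update e b (m, (e b).2))) *
      Real.log (∑ m, modePost (κ b) (e b).2 m * g (Function.update e b (m, (e b).2))))]
  unfold rowExp
  rw [← prodSum_sub]
  have hsum : ∀ x, modePost (κ b) x true + modePost (κ b) x false = 1 := fun x => by
    rw [← sum_modePost (κ b) x, Fintype.sum_bool]
  have key : ∀ (x : Bool) (e : B → Bool × Bool),
      modePost (κ b) x true * (1 - modePost (κ b) x true) *
        (√(g (Function.update e b (false, x))) - √(g (Function.update e b (true, x)))) ^ 2 ≤ _ :=
    fun x e => mul_log_gap (modePost_nonneg (κ b) x true)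
      (by linarith [hsum x, modePost_nonneg (κ b) x false])
      (hg (Function.update e b (false, x))) (hg (Function.update e b (true, x)))
  have hw : ∀ x, 0 ≤ ∑ m, cellLaw (κ b) (m, x) := fun x =>
    Finset.sum_nonneg fun m _ => cellLaw_nonneg _ _
  have hgap : ∀ e : B → Bool × Bool, ∑ x, (∑ m, cellLaw (κ b) (m, x)) *
      (modePost (κ b) x true * (1 - modePost (κ b) x true) *
      (√(g (Function.update e b (false, x))) - √(g (Function.update e b (true, x)))) ^ 2) ≤
      ∑ a, cellLaw (κ b) a * (g (Function.update e b a) * Real.log (g (Function.update e b a))) -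
      ∑ a, cellLaw (κ b) a * ((∑ m, modePost (κ b) (Function.update e b a b).2 m *
          g (Function.update (Function.update e b a) b (m, (Function.update e b a b).2))) *
        Real.log (∑ m, modePost (κ b) (Function.update e b a b).2 m *
          g (Function.update (Function.update e b a) b (m, (Function.update e b a b).2)))) := by
    intro e
    rw [← Finset.sum_sub_distrib, Fintype.sum_prod_type_right]
    refine Finset.sum_le_sum fun x _ => ?_
    refine (mul_le_mul_of_nonneg_left (key x e) (hw x)).trans (le_of_eq ?_)
    have h1 : 1 - modePost (κ b) x true = modePost (κ b) x false := by linarith [hsum x]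
    have ht := sum_cellLaw_mul_modePost (κ b) x true
    have hf := sum_cellLaw_mul_modePost (κ b) x false
    rw [h1]
    simp only [Function.update_self, Function.update_idem, Fintype.sum_bool] at ht hf ⊢
    rw [add_comm (modePost (κ b) x true * _)]
    linear_combination g (Function.update e b (true, x)) *
        Real.log (g (Function.update e b (true, x))) * ht
      + g (Function.update e b (false, x)) * Real.log (g (Function.update e b (false, x))) * hf
  split_ifs with hk
  · refine prodSum_mono (fun _ _ => cellLaw_nonneg _ _) fun e => le_trans ?_ (hgap e)
    simp only [hk, cellLaw, modePost, bern, cellBias, Fintype.sum_bool, modeLaw]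
    norm_num
    rw [← mul_assoc]
    norm_num
  · refine prodSum_nonneg (fun _ _ => cellLaw_nonneg _ _) fun e => le_trans ?_ (hgap e)
    refine Finset.sum_nonneg fun x _ => mul_nonneg (hw x) (mul_nonneg (mul_nonneg
      (modePost_nonneg _ _ _) (by linarith [hsum x, modePost_nonneg (κ b) x false])) (sq_nonneg _))

variable {V : Type*} [Fintype V]

/-- The left side is the entropy after averaging minus the entropy before it. The latter is
nonnegative, the former is at most the expected code length by Gibbs' inequality, and `hSL` allows
that length to be computed under `f` itself. -/
theorem entropy_drop_le {f : V → (B → Bool × Bool) → ℝ} (hf : ∀ v e, 0 ≤ f v e)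
    (h1 : ∀ e, ∑ v, f v e = 1) {len : V → ℝ} (hlen : ∑ v, Real.exp (-len v) ≤ 1)
    (S L : Finset B) (hSL : ∀ v, rowExp κ (resample κ S L (f v)) = rowExp κ (f v)) :
    ∑ v, (rowExp κ (fun e => resample κ ∅ ∅ (f v) e * Real.log (resample κ ∅ ∅ (f v) e))
        - rowExp κ (fun e => resample κ S L (f v) e * Real.log (resample κ S L (f v) e)))
      ≤ rowExp κ (fun e => ∑ v, f v e * len v) := by
  have hle : ∀ v e, resample κ ∅ ∅ (f v) e ≤ 1 := fun v e => by
    rw [← sum_resample (κ := κ) (S := ∅) (L := ∅) h1 e]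
    exact Finset.single_le_sum (f := fun v => resample κ ∅ ∅ (f v) e)
      (fun v _ => resample_nonneg (hf v) e) (Finset.mem_univ v)
  have hA : ∀ v, rowExp κ (fun e => resample κ ∅ ∅ (f v) e * Real.log (resample κ ∅ ∅ (f v) e))
      ≤ 0 := fun v => by
    have := rowExp_mono (κ := κ) (f := fun e => resample κ ∅ ∅ (f v) e *
      Real.log (resample κ ∅ ∅ (f v) e)) (g := fun _ => 0) fun e =>
        mul_nonpos_of_nonneg_of_nonpos (resample_nonneg (hf v) e)
          (Real.log_nonpos (resample_nonneg (hf v) e) (hle v e))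
    refine this.trans (le_of_eq ?_)
    simp [rowExp, prodSum]
  have hB : -∑ v, rowExp κ (fun e => resample κ S L (f v) e * Real.log (resample κ S L (f v) e))
      ≤ rowExp κ (fun e => ∑ v, resample κ S L (f v) e * len v) := by
    have e1 : -∑ v, rowExp κ (fun e => resample κ S L (f v) e * Real.log (resample κ S L (f v) e))
        = rowExp κ (fun e => (-1) *
          ∑ v, resample κ S L (f v) e * Real.log (resample κ S L (f v) e)) := by
      unfold rowExp
      rw [prodSum_const_mul, prodSum_sum, neg_one_mul]
    rw [e1]
    refine rowExp_mono fun e => ?_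
    rw [neg_one_mul]
    exact sum_neg_mul_log_le (fun v => resample_nonneg (hf v) e) (sum_resample h1 e) hlen
  have e2 : rowExp κ (fun e => ∑ v, resample κ S L (f v) e * len v)
      = rowExp κ (fun e => ∑ v, f v e * len v) := by
    unfold rowExp
    simp_rw [prodSum_sum, prodSum_mul_const]
    exact Finset.sum_congr rfl fun v _ => by rw [← rowExp, ← rowExp]; exact congrArg (· * _) (hSL v)
  rw [Finset.sum_sub_distrib, ← e2]
  have := Finset.sum_nonpos fun v (_ : v ∈ Finset.univ) => hA v
  linarith

theorem sum_cell_info_le (σ : B ≃ Fin N) {f : V → (B → Bool × Bool) → ℝ} (hf : ∀ v e, 0 ≤ f v e)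
    (h1 : ∀ e, ∑ v, f v e = 1) {len : V → ℝ} (hlen : ∑ v, Real.exp (-len v) ≤ 1) :
    ∑ b, (if κ b = none then rowExp κ (fun e =>
        hellSq (fun v => resample κ (earlier σ b) ∅ (f v) (Function.update e b (false, false)))
          (fun v => resample κ (earlier σ b) ∅ (f v) (Function.update e b (false, true)))) else 0)
      ≤ 6 * rowExp κ (fun e => ∑ v, f v e * len v) := by
  have hv := Finset.sum_le_sum fun v (_ : v ∈ Finset.univ) =>
    sum_chain_le σ (fun S => rowExp κ (fun e => resample κ S ∅ (f v) e *
      Real.log (resample κ S ∅ (f v) e))) _ fun S b hS => cell_step (κ := κ) hS (hf v)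
  have := hv.trans (entropy_drop_le hf h1 hlen _ _ fun v => rowExp_resample_cell _ _)
  rw [Finset.sum_comm] at this
  refine le_trans (le_of_eq ?_) (mul_le_mul_of_nonneg_left this (by norm_num : (0 : ℝ) ≤ 6))
  rw [Finset.mul_sum]
  refine Finset.sum_congr rfl fun b _ => ?_
  split_ifs with hk
  · unfold rowExp hellSq
    simp_rw [prodSum_sum, prodSum_const_mul]
    rw [← Finset.mul_sum]
    ring
  · simp

theorem sum_mode_info_le (σ : B ≃ Fin N) {f : V → (B → Bool × Bool) → ℝ} (hf : ∀ v e, 0 ≤ f v e)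
    (h1 : ∀ e, ∑ v, f v e = 1) {len : V → ℝ} (hlen : ∑ v, Real.exp (-len v) ≤ 1) :
    ∑ b, (if κ b = none then rowExp κ (fun e =>
        hellSq (fun v => resample κ ∅ (later σ b) (f v) (Function.update e b (false, true)))
          (fun v => resample κ ∅ (later σ b) (f v) (Function.update e b (true, true)))) else 0)
      ≤ 6 * rowExp κ (fun e => ∑ v, f v e * len v) := by
  have hv := Finset.sum_le_sum fun v (_ : v ∈ Finset.univ) =>
    sum_chain_le' σ (fun L => rowExp κ (fun e => resample κ ∅ L (f v) e *
      Real.log (resample κ ∅ L (f v) e))) _ fun L b hL => mode_step (κ := κ) hL (hf v)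
  have := hv.trans (entropy_drop_le hf h1 hlen _ _ fun v => rowExp_resample_mode _ _)
  rw [Finset.sum_comm] at this
  refine le_trans (le_of_eq ?_) (mul_le_mul_of_nonneg_left this (by norm_num : (0 : ℝ) ≤ 6))
  rw [Finset.mul_sum]
  refine Finset.sum_congr rfl fun b _ => ?_
  split_ifs with hk
  · unfold rowExp hellSq
    simp_rw [prodSum_sum, prodSum_const_mul]
    rw [← Finset.mul_sum]
    ring
  · simp

/-- Resampling columns other than `b` does not increase the Hellinger distance between two
contents of column `b`. -/
theorem rowExp_hellSq_resample_le {S L : Finset B} {b : B} (hS : b ∉ S) (hL : b ∉ L)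
    (hinv : ∀ u, rowExp κ (resample κ S L u) = rowExp κ u)
    {g : V → (B → Bool × Bool) → ℝ} (hg : ∀ v e, 0 ≤ g v e) (a a' : Bool × Bool) :
    rowExp κ (fun e => hellSq (fun v => resample κ S L (g v) (Function.update e b a))
        (fun v => resample κ S L (g v) (Function.update e b a')))
      ≤ rowExp κ (fun e => hellSq (fun v => g v (Function.update e b a))
        (fun v => g v (Function.update e b a'))) := by
  -- Convexity bounds the left side by the resampled right side; stationarity then removes the
  -- resampling.
  refine le_of_le_of_eq (rowExp_mono fun e => ?_) (hinv _)
  unfold resample hellSq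
  rw [prodSum_sum]
  refine Finset.sum_le_sum fun v _ => ?_
  have h := resample_update_comm (κ := κ) hS hL (g v) e
  unfold resample at h
  simp only [h]
  exact sq_sqrt_sub_sqrt_sum_le _
    (fun e' _ => Finset.prod_nonneg fun b _ => resampleKernel_nonneg S L b (e b) _)
    (fun e' => hg v _) (fun e' => hg v _)

end Chain

/-! ### Joining the two chains: flips in a column of mode one -/

section Rectangle

variable {B : Type*} [Fintype B] [DecidableEq B] {N : ℕ} {κ : B → Option Bool}
  {V : Type*} [Fintype V]

/-- The biases of the cells of a row whose cell `b` is set to `s`, whose cells in `S` are random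
given the modes, and whose other cells are known. -/
noncomputable def rowBias (κ : B → Option Bool) (S : Finset B) (b : B) (s : Bool) (M x : B → Bool)
    (b' : B) : ℝ :=
  if b' = b then bitReal s else if b' ∈ S then cellBias (κ b') (M b') else bitReal (x b')

omit [Fintype B] in
theorem rowBias_mem (S : Finset B) (b : B) (s : Bool) (M x : B → Bool) (b' : B) :
    0 ≤ rowBias κ S b s M x b' ∧ rowBias κ S b s M x b' ≤ 1 := by
  unfold rowBias
  split_ifs
  exacts [bitReal_mem _, cellBias_mem _ _, bitReal_mem _]

/-- The law of the modes when column `b` has mode `m`, the modes of the columns in `L` are random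
given one row, and the other modes are known. -/
noncomputable def modeWeight (κ : B → Option Bool) (L : Finset B) (b : B) (m : Bool)
    (e : B → Bool × Bool) (b' : B) : Bool → ℝ :=
  if b' = b then pointMass m else if b' ∈ L then modePost (κ b') (e b').2 else pointMass (e b').1

omit [Fintype B] in
theorem modeWeight_nonneg (L : Finset B) (b : B) (m : Bool) (e : B → Bool × Bool) (b' : B)
    (m' : Bool) : 0 ≤ modeWeight κ L b m e b' m' := by
  unfold modeWeight
  split_ifs
  exacts [pointMass_nonneg _ _, modePost_nonneg _ _ _, pointMass_nonneg _ _]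

/-- Given the old column, the kernel draws the new mode and the new cell independently, so a product
of a function of the modes and one of the cells stays a product. Cut and paste relies on this. -/
theorem resample_update_factor {S L : Finset B} {b : B} (hS : b ∉ S) (hL : b ∉ L)
    (R Q : (B → Bool) → ℝ) (e : B → Bool × Bool) (m s : Bool) :
    resample κ S L (fun e' => R (fun b => (e' b).1) * Q (fun b => (e' b).2))
        (Function.update e b (m, s))
      = prodSum (modeWeight κ L b m e) R *
        prodSum (fun b' => bern (rowBias κ S b s (fun b => (e b).1) (fun b => (e b).2) b')) Q := by
  rw [← prodSum_factor]
  unfold resample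
  congr 1
  funext b' a'
  by_cases h : b' = b
  · subst h
    simp [resampleKernel, hS, hL, modeWeight, rowBias, bern_bitReal]
  · unfold resampleKernel modeWeight rowBias
    simp only [h, if_false, Function.update_of_ne, ne_eq, not_false_eq_true]
    by_cases h' : b' ∈ S <;> simp [h', bern_bitReal]

/-- The distance is linear in a common factor, so averaging that factor is exact and not just a
convexity bound. -/
theorem hellSq_mul_left {β f g : V → ℝ} (hβ : ∀ v, 0 ≤ β v) :
    hellSq (fun v => β v * f v) (fun v => β v * g v) = ∑ v, β v * (√(f v) - √(g v)) ^ 2 := by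
  refine Finset.sum_congr rfl fun v _ => ?_
  rw [Real.sqrt_mul (hβ v), Real.sqrt_mul (hβ v), ← mul_sub, mul_pow, Real.sq_sqrt (hβ v)]

/-- The modes in `L` may be resampled in the first factor. -/
theorem rowExp_prodSum_modeWeight {S L : Finset B} {b : B} (hSL : Disjoint S L) (hL : b ∉ L)
    (hSLb : ∀ b', b' ≠ b → b' ∈ S ∨ b' ∈ L)
    (R : (B → Bool) → ℝ) (U : (B → Bool) → (B → Bool) → ℝ)
    (hU : ∀ M x M' x', (∀ b' ∈ S, M b' = M' b') → (∀ b' ∈ L, x b' = x' b') → U M x = U M' x') :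
    rowExp κ (fun e => prodSum (modeWeight κ L b true e) R * U (fun b => (e b).1) (fun b => (e b).2))
      = rowExp κ (fun e => R (Function.update (fun b => (e b).1) b true) *
          U (fun b => (e b).1) (fun b => (e b).2)) := by
  rw [← rowExp_resample_mode L (fun e => R (Function.update (fun b => (e b).1) b true) * _)]
  congr 1
  funext e
  -- The kernel changes only modes in `L`, which `U` does not see.
  have h1 : resample κ ∅ L (fun e' => R (Function.update (fun b => (e' b).1) b true) *
        U (fun b => (e' b).1) (fun b => (e' b).2)) e
      = resample κ ∅ L (fun e' => R (Function.update (fun b => (e' b).1) b true) *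
        U (fun b => (e b).1) (fun b => (e b).2)) e := by
    refine prodSum_congr_of_ne_zero fun e' he' => ?_
    congr 1
    refine hU _ _ _ _ (fun b' hb' => ?_) fun b' hb' => ?_
    · have h := he' b'
      simp only [resampleKernel, Finset.disjoint_left.1 hSL hb', if_false, pointMass] at h
      by_contra hne
      simp [hne] at h
    · have h := he' b'
      simp only [resampleKernel, Finset.notMem_empty, if_false, pointMass] at h
      by_contra hne
      simp [hne] at h
  rw [h1]
  unfold resample
  rw [prodSum_mul_const]
  congr 1
  have h2 := resample_update_factor (κ := κ) (Finset.notMem_empty b) hL R (fun _ => 1) e true true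
  simp only [mul_one] at h2
  rw [prodSum_const (fun b => sum_bern _), mul_one] at h2
  rw [← h2, resample_update_comm (Finset.notMem_empty b) hL]
  unfold resample
  congr 1
  funext e'
  congr 1
  funext b'
  by_cases hb : b' = b
  · subst hb; simp
  · simp [hb]

omit [DecidableEq B] in
theorem not_mem_earlier (σ : B ≃ Fin N) (b : B) : b ∉ earlier σ b := by simp [earlier]

omit [DecidableEq B] in
theorem not_mem_later (σ : B ≃ Fin N) (b : B) : b ∉ later σ b := by simp [later]

omit [DecidableEq B] in
theorem disjoint_earlier_later (σ : B ≃ Fin N) (b : B) : Disjoint (earlier σ b) (later σ b) := by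
  rw [Finset.disjoint_left]
  intro b' h h'
  simp only [earlier, later, Finset.mem_filter, Finset.mem_univ, true_and] at h h'
  exact lt_asymm h h'

omit [DecidableEq B] in
theorem mem_earlier_or_later (σ : B ≃ Fin N) {b b' : B} (h : b' ≠ b) :
    b' ∈ earlier σ b ∨ b' ∈ later σ b := by
  simp only [earlier, later, Finset.mem_filter, Finset.mem_univ, true_and]
  exact lt_or_gt_of_ne (σ.injective.ne h)

/-- The effect of flipping the cell of a column of mode one in a row, averaged over the modes and
the later cells of the row. -/
noncomputable def flipEffect (κ : B → Option Bool) (σ : B ≃ Fin N) (R Q : V → (B → Bool) → ℝ)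
    (b : B) : ℝ :=
  rowExp κ fun e => ∑ v, R v (Function.update (fun b => (e b).1) b true) *
    (√(prodSum (fun b' => bern (rowBias κ (earlier σ b) b false
          (fun b => (e b).1) (fun b => (e b).2) b')) (Q v))
      - √(prodSum (fun b' => bern (rowBias κ (earlier σ b) b true
          (fun b => (e b).1) (fun b => (e b).2) b')) (Q v))) ^ 2

/-- The two chains bound two sides of the rectangle mode × cell, and the fourth corner costs 4 and 6
times these: 60 = (4 + 6) · 6. For a free cell the corner with mode one and cell zero has
probability zero, but its densities still have mass one because `h1` holds for all `M` and `x`. -/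
theorem sum_flipEffect_le (σ : B ≃ Fin N) {R Q : V → (B → Bool) → ℝ} (hR : ∀ v M, 0 ≤ R v M)
    (hQ : ∀ v x, 0 ≤ Q v x) (h1 : ∀ M x, ∑ v, R v M * Q v x = 1)
    {len : V → ℝ} (hlen : ∑ v, Real.exp (-len v) ≤ 1) :
    ∑ b, (if κ b = none then flipEffect κ σ R Q b else 0)
      ≤ 60 * rowExp κ (fun e => ∑ v, R v (fun b => (e b).1) * Q v (fun b => (e b).2) * len v) := by
  set f : V → (B → Bool × Bool) → ℝ := fun v e => R v (fun b => (e b).1) * Q v (fun b => (e b).2)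
    with hfdef
  have hf : ∀ v e, 0 ≤ f v e := fun v e => mul_nonneg (hR _ _) (hQ _ _)
  have hf1 : ∀ e, ∑ v, f v e = 1 := fun e => h1 _ _
  have hA := sum_cell_info_le (κ := κ) σ hf hf1 hlen
  have hB := sum_mode_info_le (κ := κ) σ hf hf1 hlen
  have hb : ∀ b, flipEffect κ σ R Q b
      ≤ 4 * rowExp κ (fun e =>
        hellSq (fun v => resample κ (earlier σ b) ∅ (f v) (Function.update e b (false, false)))
          (fun v => resample κ (earlier σ b) ∅ (f v) (Function.update e b (false, true))))
      + 6 * rowExp κ (fun e =>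
        hellSq (fun v => resample κ ∅ (later σ b) (f v) (Function.update e b (false, true)))
          (fun v => resample κ ∅ (later σ b) (f v) (Function.update e b (true, true)))) := by
    intro b
    have hS := not_mem_earlier σ b
    have hL := not_mem_later σ b
    have hSL := disjoint_earlier_later σ b
    have hA' := rowExp_hellSq_resample_le (κ := κ) (Finset.notMem_empty b) hL
      (rowExp_resample_mode _) (fun v => resample_nonneg (κ := κ) (S := earlier σ b) (L := ∅) (hf v))
      (false, false) (false, true)
    have hB' := rowExp_hellSq_resample_le (κ := κ) hS (Finset.notMem_empty b)
      (rowExp_resample_cell _) (fun v => resample_nonneg (κ := κ) (S := ∅) (L := later σ b) (hf v))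
      (false, true) (true, true)
    -- Both estimates now concern the same densities, with earlier cells and later modes averaged.
    simp_rw [resample_mode_cell hSL] at hA'
    simp_rw [resample_cell_mode hSL] at hB'
    refine le_trans ?_ (add_le_add (mul_le_mul_of_nonneg_left hA' (by norm_num))
      (mul_le_mul_of_nonneg_left hB' (by norm_num)))
    unfold flipEffect
    simp_rw [hfdef, resample_update_factor hS hL]
    set α : (B → Bool × Bool) → Bool → V → ℝ := fun e s v =>
      prodSum (fun b' => bern (rowBias κ (earlier σ b) b s
          (fun b => (e b).1) (fun b => (e b).2) b')) (Q v) with hα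
    set β : (B → Bool × Bool) → Bool → V → ℝ := fun e m v =>
      prodSum (modeWeight κ (later σ b) b m e) (R v) with hβ
    have hα0 : ∀ e s v, 0 ≤ α e s v := fun e s v =>
      prodSum_nonneg (fun b' _ => bern_nonneg (rowBias_mem _ _ _ _ _ _) _) (hQ v)
    have hβ0 : ∀ e s v, 0 ≤ β e s v := fun e s v =>
      prodSum_nonneg (fun b' _ => modeWeight_nonneg _ _ _ _ _ _) (hR v)
    have hsum : ∀ e m s, ∑ v, β e m v * α e s v = 1 := by
      intro e m s
      rw [← sum_resample (κ := κ) (S := earlier σ b) (L := later σ b) hf1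
        (Function.update e b (m, s))]
      exact Finset.sum_congr rfl fun v _ => (resample_update_factor hS hL _ _ _ _ _).symm
    have hcorner := rowExp_mono (κ := κ) fun e => hellSq_fourth_corner (hα0 e) (hβ0 e) (hsum e)
    have e1 : rowExp κ (fun e => 4 * hellSq (fun v => β e false v * α e false v)
          (fun v => β e false v * α e true v) + 6 * hellSq (fun v => β e false v * α e true v)
          (fun v => β e true v * α e true v))
        = 4 * rowExp κ (fun e => hellSq (fun v => β e false v * α e false v)
          (fun v => β e false v * α e true v)) + 6 * rowExp κ (fun e =>
          hellSq (fun v => β e false v * α e true v) (fun v => β e true v * α e true v)) := by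
      unfold rowExp
      rw [prodSum_add, prodSum_const_mul, prodSum_const_mul]
    rw [e1] at hcorner
    refine le_trans (le_of_eq ?_) hcorner
    simp_rw [hellSq_mul_left (hβ0 _ true)]
    unfold rowExp
    rw [prodSum_sum, prodSum_sum]
    refine Finset.sum_congr rfl fun v _ => ?_
    -- The flip in `α` depends only on earlier modes and later cells, so the averaging of later
    -- modes in `β` is absorbed by the outer expectation.
    refine (rowExp_prodSum_modeWeight (κ := κ) hSL hL (fun b' => mem_earlier_or_later σ) (R v)
      (fun M x => (√(prodSum (fun b' => bern (rowBias κ (earlier σ b) b false M x b')) (Q v))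
      - √(prodSum (fun b' => bern (rowBias κ (earlier σ b) b true M x b')) (Q v))) ^ 2) ?_).symm
    intro M x M' x' hM hx
    have : ∀ s b', rowBias κ (earlier σ b) b s M x b' = rowBias κ (earlier σ b) b s M' x' b' := by
      intro s b'
      unfold rowBias
      split_ifs with h h'
      · rfl
      · rw [hM b' h']
      · rw [hx b' ((mem_earlier_or_later σ h).resolve_left h')]
    simp_rw [this]
  have hsum : ∑ b, (if κ b = none then flipEffect κ σ R Q b else 0)
      ≤ ∑ b, (4 * (if κ b = none then rowExp κ (fun e =>
        hellSq (fun v => resample κ (earlier σ b) ∅ (f v) (Function.update e b (false, false)))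
          (fun v => resample κ (earlier σ b) ∅ (f v) (Function.update e b (false, true)))) else 0)
      + 6 * (if κ b = none then rowExp κ (fun e =>
        hellSq (fun v => resample κ ∅ (later σ b) (f v) (Function.update e b (false, true)))
          (fun v => resample κ ∅ (later σ b) (f v) (Function.update e b (true, true)))) else 0)) := by
    refine Finset.sum_le_sum fun b _ => ?_
    split_ifs
    · exact hb b
    · simp
  rw [Finset.sum_add_distrib, ← Finset.mul_sum, ← Finset.mul_sum] at hsum
  linarith

end Rectangle

/-! ### Laws of transcripts with the rectangle property -/

/-- A family of laws on a finite set of transcripts, indexed by the inputs of the players, which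
factors into a part of the coordinator and, for each player, a part that only depends on the input
and the view of this player. -/
structure TranscriptLaw (k : ℕ) (B τ V : Type*) [Fintype τ] where
  /-- the part of the coordinator -/
  coord : τ → ℝ
  /-- the part of a player -/
  factor : Fin k → (B → Bool) → V → ℝ
  /-- the view of a player -/
  view : Fin k → τ → V
  coord_nonneg : ∀ t, 0 ≤ coord t
  factor_nonneg : ∀ i x v, 0 ≤ factor i x v
  sum_eq_one : ∀ X : Fin k → B → Bool, ∑ t, coord t * ∏ i, factor i (X i) (view i t) = 1

namespace TranscriptLaw

variable {k : ℕ} {B τ V : Type*} [Fintype τ]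

/-- The law of the transcript on the inputs `X`. -/
noncomputable def prob (L : TranscriptLaw k B τ V) (X : Fin k → B → Bool) (t : τ) : ℝ :=
  L.coord t * ∏ i, L.factor i (X i) (L.view i t)

variable [Fintype B] [DecidableEq B] (L : TranscriptLaw k B τ V)

/-- The part of player `i` when the cells of this player's row are independent with biases `p`. -/
noncomputable def rowFactor (i : Fin k) (p : B → ℝ) (v : V) : ℝ :=
  prodSum (fun b => bern (p b)) fun x => L.factor i x v

/-- The law of the transcript when all cells are independent with biases `p`. -/
noncomputable def mixed (p : Fin k → B → ℝ) (t : τ) : ℝ :=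
  L.coord t * ∏ i, L.rowFactor i (p i) (L.view i t)

variable {L}

theorem rowFactor_nonneg {i : Fin k} {p : B → ℝ} (hp : ∀ b, 0 ≤ p b ∧ p b ≤ 1) (v : V) :
    0 ≤ L.rowFactor i p v :=
  prodSum_nonneg (fun b _ => bern_nonneg (hp b) _) fun x => L.factor_nonneg i x v

theorem mixed_nonneg {p : Fin k → B → ℝ} (hp : ∀ i b, 0 ≤ p i b ∧ p i b ≤ 1) (t : τ) :
    0 ≤ L.mixed p t :=
  mul_nonneg (L.coord_nonneg t) (Finset.prod_nonneg fun i _ => rowFactor_nonneg (hp i) _)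

theorem rowFactor_bitReal (i : Fin k) (x : B → Bool) (v : V) :
    L.rowFactor i (fun b => bitReal (x b)) v = L.factor i x v := by
  unfold rowFactor
  simp_rw [bern_bitReal]
  exact prodSum_pointMass x _

/-- Tower property: cells in `D` are drawn first, the others averaged afterwards. -/
theorem prodSum_rowFactor (i : Fin k) (D : Finset B) {p p' : B → ℝ} (h : ∀ b ∈ D, p' b = p b)
    (v : V) :
    prodSum (fun b => bern (p' b))
        (fun x => L.rowFactor i (fun b => if b ∈ D then bitReal (x b) else p b) v)
      = L.rowFactor i p v := by
  unfold rowFactor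
  have := prodSum_bind (ω := fun b => bern (p' b))
    (K := fun b s => bern (if b ∈ D then bitReal s else p b)) (g := fun x => L.factor i x v)
  rw [this]
  congr 1
  funext b x
  by_cases hb : b ∈ D
  · simp only [hb, if_true, bern_bitReal, pointMass, h b hb]
    cases x <;> simp
  · simp only [hb, if_false]
    rw [← Finset.sum_mul, sum_bern, one_mul]

theorem sum_prod_mul_mixed {p : Fin k → B → ℝ} (g : τ → ℝ) :
    ∑ t, L.mixed p t * g t
      = ∑ X : Fin k → B → Bool, (∏ i, ∏ b, bern (p i b) (X i b)) * ∑ t, L.prob X t * g t := by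
  have : ∀ t, L.mixed p t
      = ∑ X : Fin k → B → Bool, (∏ i, ∏ b, bern (p i b) (X i b)) * L.prob X t := by
    intro t
    unfold mixed rowFactor prodSum prob
    rw [Finset.prod_univ_sum, Fintype.piFinset_univ, Finset.mul_sum]
    refine Finset.sum_congr rfl fun X _ => ?_
    rw [Finset.prod_mul_distrib]
    ring
  simp_rw [this, Finset.mul_sum, Finset.sum_mul]
  rw [Finset.sum_comm]
  simp_rw [mul_assoc]

theorem sum_prod_prod_bern (p : Fin k → B → ℝ) :
    ∑ X : Fin k → B → Bool, ∏ i, ∏ b, bern (p i b) (X i b) = 1 := by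
  have h := Finset.prod_univ_sum (fun _ : Fin k => (Finset.univ : Finset (B → Bool)))
    fun i x => ∏ b, bern (p i b) (x b)
  rw [Fintype.piFinset_univ] at h
  rw [← h]
  refine Finset.prod_eq_one fun i _ => ?_
  have := prodSum_const (ω := fun b => bern (p i b)) (fun b => sum_bern _) 1
  simpa [prodSum] using this

theorem sum_mixed (p : Fin k → B → ℝ) : ∑ t, L.mixed p t = 1 := by
  have := sum_prod_mul_mixed (L := L) (p := p) fun _ => 1
  simp only [mul_one] at this
  rw [this]
  have h : ∀ X, ∑ t, L.prob X t = 1 := L.sum_eq_one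
  simp_rw [h, mul_one]
  exact sum_prod_prod_bern p

/-- A worst-case error bound passes to mixtures, and only inputs in the support matter. -/
theorem sum_mixed_mul_le {p : Fin k → B → ℝ} (hp : ∀ i b, 0 ≤ p i b ∧ p i b ≤ 1) (g : τ → ℝ)
    {δ : ℝ} (h : ∀ X : Fin k → B → Bool, (∀ i b, bern (p i b) (X i b) ≠ 0) →
      ∑ t, L.prob X t * g t ≤ δ) : ∑ t, L.mixed p t * g t ≤ δ := by
  rw [sum_prod_mul_mixed]
  calc _ ≤ ∑ X : Fin k → B → Bool, (∏ i, ∏ b, bern (p i b) (X i b)) * δ := by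
        refine Finset.sum_le_sum fun X _ => ?_
        by_cases h0 : ∏ i, ∏ b, bern (p i b) (X i b) = 0
        · rw [h0, zero_mul, zero_mul]
        · refine mul_le_mul_of_nonneg_left (h X fun i b => ?_) (Finset.prod_nonneg fun i _ =>
            Finset.prod_nonneg fun b _ => bern_nonneg (hp i b) _)
          exact Finset.prod_ne_zero_iff.1 (Finset.prod_ne_zero_iff.1 h0 i (Finset.mem_univ i)) b
            (Finset.mem_univ b)
    _ = δ := by rw [← Finset.sum_mul, sum_prod_prod_bern, one_mul]

/-! ### The hard distribution, all rows at once -/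

/-- The expectation over the modes and all rows. -/
noncomputable def fullExp (kd : Fin k → B → Option Bool)
    (g : (B → Bool) → (Fin k → B → Bool) → ℝ) : ℝ :=
  prodSum (fun b (a : Bool × (Fin k → Bool)) =>
      modeLaw a.1 * ∏ l, bern (cellBias (kd l b) a.1) (a.2 l))
    fun e => g (fun b => (e b).1) fun l b => (e b).2 l

theorem fullExp_eq (kd : Fin k → B → Option Bool) (g : (B → Bool) → (Fin k → B → Bool) → ℝ) :
    fullExp kd g = prodSum (fun _ => modeLaw) fun M =>
      ∑ X : Fin k → B → Bool, (∏ l, ∏ b, bern (cellBias (kd l b) (M b)) (X l b)) * g M X := by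
  unfold fullExp
  rw [← prodSum_pair (ω := fun _ => modeLaw)
    (K := fun b m (y : Fin k → Bool) => ∏ l, bern (cellBias (kd l b) m) (y l))
    (g := fun M y => g M fun l b => y b l)]
  congr 1
  funext M
  unfold prodSum
  rw [← (Equiv.piComm fun (_ : Fin k) (_ : B) => Bool).sum_comp]
  refine Finset.sum_congr rfl fun X _ => ?_
  rw [Finset.prod_comm]
  rfl

theorem rowExp_eq (κ : B → Option Bool) (g : (B → Bool) → (B → Bool) → ℝ) :
    rowExp κ (fun e => g (fun b => (e b).1) fun b => (e b).2)
      = prodSum (fun _ => modeLaw) fun M =>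
        prodSum (fun b => bern (cellBias (κ b) (M b))) (g M) :=
  (prodSum_pair (ω := fun _ => modeLaw) (K := fun b m => bern (cellBias (κ b) m)) (g := g)).symm

omit [Fintype B] [DecidableEq B] in
theorem fullWeight_nonneg (kd : Fin k → B → Option Bool) (b : B) (a : Bool × (Fin k → Bool)) :
    0 ≤ modeLaw a.1 * ∏ l, bern (cellBias (kd l b) a.1) (a.2 l) :=
  mul_nonneg (modeLaw_nonneg _) (Finset.prod_nonneg fun _ _ => bern_nonneg (cellBias_mem _ _) _)

omit [Fintype B] [DecidableEq B] in
theorem sum_fullWeight (kd : Fin k → B → Option Bool) (b : B) :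
    ∑ a : Bool × (Fin k → Bool), modeLaw a.1 * ∏ l, bern (cellBias (kd l b) a.1) (a.2 l) = 1 := by
  rw [Fintype.sum_prod_type]
  simp_rw [← Finset.mul_sum]
  have h : ∀ m, ∑ y : Fin k → Bool, ∏ l, bern (cellBias (kd l b) m) (y l) = 1 := fun m => by
    have := prodSum_const (ω := fun l : Fin k => bern (cellBias (kd l b) m)) (fun l => sum_bern _) 1
    simpa [prodSum] using this
  simp_rw [h, mul_one]
  exact sum_modeLaw

/-- The integrand ignores columns `b` and `c`, so their laws may be replaced one after the other.
Moving a planted column or a mark changes the kinds only there. -/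
theorem fullExp_congr {kd kd' : Fin k → B → Option Bool} {b c : B}
    (h : ∀ l b', b' ≠ b → b' ≠ c → kd l b' = kd' l b')
    {g : (B → Bool) → (Fin k → B → Bool) → ℝ}
    (hg : ∀ M x M' x', (∀ b', b' ≠ b → b' ≠ c → M b' = M' b') →
      (∀ l b', b' ≠ b → b' ≠ c → x l b' = x' l b') → g M x = g M' x') :
    fullExp kd g = fullExp kd' g := by
  set G : (B → Bool × (Fin k → Bool)) → ℝ := fun e => g (fun b => (e b).1) fun l b => (e b).2 l
    with hG
  set ω : (Fin k → B → Option Bool) → B → Bool × (Fin k → Bool) → ℝ := fun kd b a =>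
    modeLaw a.1 * ∏ l, bern (cellBias (kd l b) a.1) (a.2 l) with hω
  have hGb : ∀ d, d = b ∨ d = c → ∀ e a, G (Function.update e d a) = G e := by
    intro d hd e a
    refine hg _ _ _ _ (fun b' h1 h2 => ?_) fun l b' h1 h2 => ?_ <;>
    · have : b' ≠ d := by rcases hd with rfl | rfl <;> assumption
      simp [this]
  have hsum : ∀ kd d, ∑ a, ω kd d a = 1 := fun kd d => sum_fullWeight kd d
  have e1 := prodSum_update_of_insensitive (ω kd) b (ω kd' b) (hsum _ _) (hsum _ _) G
    (hGb b (Or.inl rfl))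
  have e2 := prodSum_update_of_insensitive (Function.update (ω kd) b (ω kd' b)) c (ω kd' c)
    (by by_cases hbc : c = b
        · subst hbc; rw [Function.update_self]; exact hsum _ _
        · rw [Function.update_of_ne hbc]; exact hsum _ _) (hsum _ _) G (hGb c (Or.inr rfl))
  have e3 : Function.update (Function.update (ω kd) b (ω kd' b)) c (ω kd' c) = ω kd' := by
    funext b'
    by_cases hc : b' = c
    · subst hc; simp
    · by_cases hb : b' = b
      · subst hb; simp [hc]
      · simp [hc, hb, hω, h _ b' hb hc]
  rw [e3, e1] at e2
  exact e2.symm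

theorem fullExp_mono_of_ne_zero {kd : Fin k → B → Option Bool}
    {g h : (B → Bool) → (Fin k → B → Bool) → ℝ}
    (hgh : ∀ M x, (∀ l b, bern (cellBias (kd l b) (M b)) (x l b) ≠ 0) → g M x ≤ h M x) :
    fullExp kd g ≤ fullExp kd h := by
  refine Finset.sum_le_sum fun e _ => ?_
  by_cases h0 : ∏ b, (modeLaw (e b).1 * ∏ l, bern (cellBias (kd l b) (e b).1) ((e b).2 l)) = 0
  · rw [h0, zero_mul, zero_mul]
  · refine mul_le_mul_of_nonneg_left (hgh _ _ fun l b => ?_)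
      (Finset.prod_nonneg fun b _ => fullWeight_nonneg kd b _)
    have := Finset.prod_ne_zero_iff.1 h0 b (Finset.mem_univ b)
    exact Finset.prod_ne_zero_iff.1 (mul_ne_zero_iff.1 this).2 l (Finset.mem_univ l)

/-- The biases of all cells when the cells of two columns `b` and `c` are set according to `y`,
the cells in `S` are random given the modes, and the other cells are known. -/
noncomputable def pairBias (kd : Fin k → B → Option Bool) (S : Finset B) (b c : B)
    (y : Fin k → Bool × Bool) (M : B → Bool) (x : Fin k → B → Bool) (l : Fin k) (b' : B) : ℝ :=
  if b' = b then bitReal (y l).1 else if b' = c then bitReal (y l).2 else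
    if b' ∈ S then cellBias (kd l b') (M b') else bitReal (x l b')

omit [Fintype B] in
theorem pairBias_mem (kd : Fin k → B → Option Bool) (S : Finset B) (b c : B)
    (y : Fin k → Bool × Bool) (M : B → Bool) (x : Fin k → B → Bool) (l : Fin k) (b' : B) :
    0 ≤ pairBias kd S b c y M x l b' ∧ pairBias kd S b c y M x l b' ≤ 1 := by
  unfold pairBias
  split_ifs
  exacts [bitReal_mem _, bitReal_mem _, cellBias_mem _ _, bitReal_mem _]

variable [Fintype V] [DecidableEq V] {N : ℕ}

/-- The part of all parties other than `i`, as a function of the view of `i` and the modes. -/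
noncomputable def restFactor (L : TranscriptLaw k B τ V) (kd : Fin k → B → Option Bool) (i : Fin k)
    (v : V) (M : B → Bool) : ℝ :=
  ∑ t, if L.view i t = v then L.coord t * ∏ l ∈ Finset.univ.erase i,
    L.rowFactor l (fun b => cellBias (kd l b) (M b)) (L.view l t) else 0

omit [Fintype V] in
theorem restFactor_nonneg (kd : Fin k → B → Option Bool) (i : Fin k) (v : V) (M : B → Bool) :
    0 ≤ L.restFactor kd i v M := by
  refine Finset.sum_nonneg fun t _ => ?_
  split_ifs
  · exact mul_nonneg (L.coord_nonneg t) (Finset.prod_nonneg fun l _ =>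
      rowFactor_nonneg (fun b => cellBias_mem _ _) _)
  · exact le_rfl

theorem sum_restFactor_mul (kd : Fin k → B → Option Bool) (i : Fin k) (M : B → Bool) (g : V → ℝ) :
    ∑ v, L.restFactor kd i v M * g v = ∑ t, (L.coord t * ∏ l ∈ Finset.univ.erase i,
      L.rowFactor l (fun b => cellBias (kd l b) (M b)) (L.view l t)) * g (L.view i t) := by
  unfold restFactor
  simp_rw [Finset.sum_mul]
  rw [Finset.sum_comm]
  refine Finset.sum_congr rfl fun t _ => ?_
  simp_rw [ite_mul, zero_mul]
  simp

/-- This is the mass of a mixed law whose row `i` is deterministic, hence one even for improbable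
pairs `M`, `x`. -/
theorem sum_restFactor_mul_factor (kd : Fin k → B → Option Bool) (i : Fin k) (M x : B → Bool) :
    ∑ v, L.restFactor kd i v M * L.factor i x v = 1 := by
  rw [sum_restFactor_mul, ← sum_mixed (L := L)
    (Function.update (fun l b => cellBias (kd l b) (M b)) i fun b => bitReal (x b))]
  refine Finset.sum_congr rfl fun t _ => ?_
  unfold mixed
  rw [← Finset.mul_prod_erase _ _ (Finset.mem_univ i), Function.update_self, rowFactor_bitReal,
    mul_assoc, mul_comm (L.factor i x _)]
  congr 2
  refine Finset.prod_congr rfl fun l hl => ?_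
  rw [Function.update_of_ne (Finset.ne_of_mem_erase hl)]

/-- The effect on the transcript of flipping the cell of player `i` in column `b`. -/
noncomputable def effect (L : TranscriptLaw k B τ V) (kd : Fin k → B → Option Bool)
    (σ : B ≃ Fin N) (i : Fin k) (b : B) : ℝ :=
  flipEffect (kd i) σ (fun v => L.restFactor kd i v) (fun v x => L.factor i x v) b

/-- Each player pays the expected code length of its own view. The joint law of modes and transcript
does not depend on `i`, so the lengths add up under one law to at most `Λ`. -/
theorem sum_effect_le (kd : Fin k → B → Option Bool) (σ : B ≃ Fin N) {len : V → ℝ}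
    (hlen : ∑ v, Real.exp (-len v) ≤ 1) {Λ : ℝ} (hΛ : ∀ t, ∑ i, len (L.view i t) ≤ Λ) :
    ∑ i, ∑ b, (if kd i b = none then L.effect kd σ i b else 0) ≤ 60 * Λ := by
  have h := Finset.sum_le_sum fun i (_ : i ∈ Finset.univ) =>
    sum_flipEffect_le (κ := kd i) σ (R := fun v => L.restFactor kd i v)
      (Q := fun v x => L.factor i x v) (fun v M => restFactor_nonneg kd i v M)
      (fun v x => L.factor_nonneg i x v) (fun M x => sum_restFactor_mul_factor kd i M x) hlen
  refine h.trans ?_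
  rw [← Finset.mul_sum]
  refine mul_le_mul_of_nonneg_left ?_ (by norm_num)
  have e : ∀ i, rowExp (kd i) (fun e => ∑ v, L.restFactor kd i v (fun b => (e b).1) *
        L.factor i (fun b => (e b).2) v * len v)
      = prodSum (fun _ => modeLaw) fun M =>
        ∑ t, L.mixed (fun l b => cellBias (kd l b) (M b)) t * len (L.view i t) := by
    intro i
    rw [rowExp_eq (kd i) fun M x => ∑ v, L.restFactor kd i v M * L.factor i x v * len v]
    congr 1
    funext M
    simp_rw [mul_assoc, sum_restFactor_mul kd i M]
    rw [prodSum_sum]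
    refine Finset.sum_congr rfl fun t _ => ?_
    rw [prodSum_const_mul, prodSum_mul_const, mixed,
      ← Finset.mul_prod_erase _ _ (Finset.mem_univ i), rowFactor]
    ring
  simp_rw [e]
  rw [← prodSum_sum]
  refine (prodSum_mono (fun _ => modeLaw_nonneg) fun M => ?_).trans
    (le_of_eq (prodSum_const (fun _ => sum_modeLaw) Λ))
  rw [Finset.sum_comm]
  simp_rw [← Finset.mul_sum]
  calc _ ≤ ∑ t, L.mixed (fun l b => cellBias (kd l b) (M b)) t * Λ :=
        Finset.sum_le_sum fun t _ => mul_le_mul_of_nonneg_left (hΛ t)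
          (mixed_nonneg (fun _ _ => cellBias_mem _ _) t)
    _ = Λ := by rw [← Finset.sum_mul, sum_mixed, one_mul]

omit [Fintype V] [DecidableEq V] in
theorem hellSq_mixed {p p' : Fin k → B → ℝ} (hp : ∀ i b, 0 ≤ p i b ∧ p i b ≤ 1) {i : Fin k}
    (h : ∀ l, l ≠ i → p' l = p l) :
    hellSq (L.mixed p) (L.mixed p') = ∑ t, (L.coord t * ∏ l ∈ Finset.univ.erase i,
      L.rowFactor l (p l) (L.view l t)) *
        (√(L.rowFactor i (p i) (L.view i t)) - √(L.rowFactor i (p' i) (L.view i t))) ^ 2 := by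
  have e : ∀ t, 0 ≤ L.coord t * ∏ l ∈ Finset.univ.erase i, L.rowFactor l (p l) (L.view l t) :=
    fun t => mul_nonneg (L.coord_nonneg t) (Finset.prod_nonneg fun l _ => rowFactor_nonneg (hp l) _)
  rw [← hellSq_mul_left e]
  congr 1
  · funext t
    rw [mixed, ← Finset.mul_prod_erase _ _ (Finset.mem_univ i)]
    ring
  · funext t
    rw [mixed, ← Finset.mul_prod_erase _ _ (Finset.mem_univ i)]
    have : ∏ l ∈ Finset.univ.erase i, L.rowFactor l (p' l) (L.view l t)
        = ∏ l ∈ Finset.univ.erase i, L.rowFactor l (p l) (L.view l t) :=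
      Finset.prod_congr rfl fun l hl => by rw [h l (Finset.ne_of_mem_erase hl)]
    rw [this]
    ring

/-- The squared difference belonging to row `i` is weighted linearly by the factors of the other
players, so their later cells may be either averaged or revealed. Mode `true` in column `b` gives
the others the cells prescribed by `y`, and the planted column `c` is deterministic wherever it
stands in the order. -/
theorem effect_eq_fullExp (kd : Fin k → B → Option Bool) (σ : B ≃ Fin N) {i : Fin k} {b c : B}
    (hcb : c ≠ b) (hc : ∀ l, kd l c = some true) {y y' : Fin k → Bool × Bool}
    (hy : y i = (false, true)) (hy' : y' i = (true, true)) (hyy : ∀ l, l ≠ i → y' l = y l)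
    (hl : ∀ l, l ≠ i → cellBias (kd l b) true = bitReal (y l).1 ∧ (y l).2 = true) :
    L.effect kd σ i b = fullExp kd fun M x =>
      hellSq (L.mixed (pairBias kd (earlier σ b) b c y M x))
        (L.mixed (pairBias kd (earlier σ b) b c y' M x)) := by
  rw [fullExp_eq, effect, flipEffect]
  rw [rowExp_eq (kd i) fun M x => ∑ v, L.restFactor kd i v (Function.update M b true) *
    (√(prodSum (fun b' => bern (rowBias (kd i) (earlier σ b) b false M x b'))
          (fun x => L.factor i x v))
      - √(prodSum (fun b' => bern (rowBias (kd i) (earlier σ b) b true M x b'))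
          (fun x => L.factor i x v))) ^ 2]
  congr 1
  funext M
  simp_rw [sum_restFactor_mul kd i]
  have hpp : ∀ x l, l ≠ i → pairBias kd (earlier σ b) b c y' M x l
      = pairBias kd (earlier σ b) b c y M x l := fun x l hl => by
    funext b'; unfold pairBias; rw [hyy l hl]
  have h1 : ∀ x, hellSq (L.mixed (pairBias kd (earlier σ b) b c y M x))
        (L.mixed (pairBias kd (earlier σ b) b c y' M x)) = _ := fun x =>
    hellSq_mixed (fun _ _ => pairBias_mem _ _ _ _ _ _ _ _ _) (hpp x)
  simp_rw [h1, Finset.mul_sum]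
  rw [Finset.sum_comm, prodSum_sum]
  refine Finset.sum_congr rfl fun t _ => ?_
  -- The columns outside the pair whose cells are revealed.
  set D : Finset B := Finset.univ.filter fun b' => b' ≠ b ∧ b' ≠ c ∧ b' ∉ earlier σ b with hD
  let row : Fin k → (B → Bool) → B → ℝ := fun l x b' =>
    pairBias kd (earlier σ b) b c y M (fun _ => x) l b'
  let row' : (B → Bool) → B → ℝ := fun x b' =>
    pairBias kd (earlier σ b) b c y' M (fun _ => x) i b'
  let h : Fin k → (B → Bool) → ℝ := fun l x => if l = i then
    (√(L.rowFactor i (row i x) (L.view i t)) - √(L.rowFactor i (row' x) (L.view i t))) ^ 2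
    else L.rowFactor l (row l x) (L.view l t)
  have h2 : ∀ X : Fin k → B → Bool, (∏ l, ∏ b, bern (cellBias (kd l b) (M b)) (X l b)) *
      ((L.coord t * ∏ l ∈ Finset.univ.erase i,
        L.rowFactor l (pairBias kd (earlier σ b) b c y M X l) (L.view l t)) *
        (√(L.rowFactor i (pairBias kd (earlier σ b) b c y M X i) (L.view i t))
          - √(L.rowFactor i (pairBias kd (earlier σ b) b c y' M X i) (L.view i t))) ^ 2)
      = L.coord t * ∏ l, ((∏ b, bern (cellBias (kd l b) (M b)) (X l b)) * h l (X l)) := by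
    intro X
    rw [Finset.prod_mul_distrib, ← Finset.mul_prod_erase _ (fun l => h l (X l)) (Finset.mem_univ i)]
    have : ∏ l ∈ Finset.univ.erase i, h l (X l) = ∏ l ∈ Finset.univ.erase i,
        L.rowFactor l (pairBias kd (earlier σ b) b c y M X l) (L.view l t) :=
      Finset.prod_congr rfl fun l hl => by
        simp only [h, if_neg (Finset.ne_of_mem_erase hl)]; rfl
    rw [this]
    simp only [h, if_true]
    have e1 : row i (X i) = pairBias kd (earlier σ b) b c y M X i := rfl
    have e2 : row' (X i) = pairBias kd (earlier σ b) b c y' M X i := rfl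
    rw [e1, e2]
    ring
  simp_rw [h2]
  rw [← Finset.mul_sum]
  -- The summand factors over rows, so the sum over matrices is a product of sums over rows.
  have h3 := Finset.prod_univ_sum (fun _ : Fin k => (Finset.univ : Finset (B → Bool)))
    fun l x => (∏ b, bern (cellBias (kd l b) (M b)) (x b)) * h l x
  rw [Fintype.piFinset_univ] at h3
  rw [← h3, ← Finset.mul_prod_erase _ _ (Finset.mem_univ i), prodSum_const_mul, mul_assoc]
  congr 1
  rw [mul_comm]
  congr 1
  · refine prodSum_congr_of_ne_zero fun x hx => ?_
    have hxc : x c = true := by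
      have := hx c
      rw [hc i] at this
      by_contra hne
      simp only [Bool.not_eq_true] at hne
      simp [hne, cellBias, bitReal, bern] at this
    have hrow : ∀ s (z : Fin k → Bool × Bool), z i = (s, true) →
        rowBias (kd i) (earlier σ b) b s M x
          = fun b' => pairBias kd (earlier σ b) b c z M (fun _ => x) i b' := by
      intro s z hz
      funext b'
      unfold rowBias pairBias
      rw [hz]
      by_cases hb : b' = b
      · simp [hb]
      · by_cases hbc : b' = c
        · subst hbc
          simp [hb, hc i, cellBias, hxc]
        · simp [hb, hbc]
    simp only [h, if_true, row, row', ← hrow _ _ hy, ← hrow _ _ hy']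
    rfl
  · refine Finset.prod_congr rfl fun l hle => ?_
    have hli := Finset.ne_of_mem_erase hle
    simp only [h, if_neg hli]
    have hrow : ∀ x : B → Bool, (fun b' => if b' ∈ D then bitReal (x b') else
        cellBias (kd l b') (Function.update M b true b')) = row l x := by
      intro x
      funext b'
      simp only [row, pairBias, hD, Finset.mem_filter, Finset.mem_univ, true_and]
      by_cases hb : b' = b
      · subst hb; simp [(hl l hli).1]
      · by_cases hbc : b' = c
        · subst hbc; simp [hb, hc l, cellBias, (hl l hli).2]
        · by_cases hbS : b' ∈ earlier σ b <;> simp [hb, hbc, hbS]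
    have hD' : ∀ b' ∈ D, cellBias (kd l b') (M b')
        = cellBias (kd l b') (Function.update M b true b') := by
      intro b' hb'
      simp only [hD, Finset.mem_filter, Finset.mem_univ, true_and] at hb'
      rw [Function.update_of_ne hb'.1]
    have hp := prodSum_rowFactor (L := L) l D hD' (L.view l t)
    simp only [hrow] at hp
    exact hp.symm

end TranscriptLaw

/-- Two densities under which a test errs with probability at most `δ` are far apart. -/
theorem sq_le_four_mul_hellSq {τ : Type*} [Fintype τ] {f g : τ → ℝ} (hf : ∀ t, 0 ≤ f t)
    (hg : ∀ t, 0 ≤ g t) (sf : ∑ t, f t = 1) (sg : ∑ t, g t = 1) (ans : τ → Bool) {δ : ℝ}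
    (hδ : 0 ≤ 1 - 2 * δ) (ef : ∑ t, f t * (if ans t = false then 0 else 1) ≤ δ)
    (eg : ∑ t, g t * (if ans t = true then 0 else 1) ≤ δ) :
    (1 - 2 * δ) ^ 2 ≤ 4 * hellSq f g := by
  -- The advantage of the test, with `g - f` factored as a difference of squares to prepare
  -- Cauchy–Schwarz.
  have h1 : 1 - 2 * δ ≤ ∑ t, (√(g t) - √(f t)) * ((√(g t) + √(f t)) *
      (if ans t = true then 1 else 0)) := by
    have e : ∑ t, (√(g t) - √(f t)) * ((√(g t) + √(f t)) * (if ans t = true then 1 else 0))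
        = ∑ t, g t - ∑ t, g t * (if ans t = true then 0 else 1)
          - ∑ t, f t * (if ans t = false then 0 else 1) := by
      rw [← Finset.sum_sub_distrib, ← Finset.sum_sub_distrib]
      refine Finset.sum_congr rfl fun t _ => ?_
      cases ans t
      · simp
      · simp only [if_true, Bool.true_eq_false, if_false]
        linear_combination Real.sq_sqrt (hg t) - Real.sq_sqrt (hf t)
    rw [e, sg]; linarith
  have h2 := Finset.sum_mul_sq_le_sq_mul_sq Finset.univ (fun t => √(g t) - √(f t))
    fun t => (√(g t) + √(f t)) * (if ans t = true then 1 else 0)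
  have h3 : ∑ t, ((√(g t) + √(f t)) * (if ans t = true then 1 else 0)) ^ 2 ≤ 4 := by
    calc _ ≤ ∑ t, (2 * g t + 2 * f t) := by
          refine Finset.sum_le_sum fun t _ => ?_
          split_ifs
          · nlinarith [Real.sq_sqrt (hg t), Real.sq_sqrt (hf t), sq_nonneg (√(g t) - √(f t))]
          · have := hf t; have := hg t; simp; positivity
      _ = 4 := by rw [Finset.sum_add_distrib, ← Finset.mul_sum, ← Finset.mul_sum, sf, sg]; norm_num
  have h4 : (1 - 2 * δ) ^ 2 ≤ _ := (pow_le_pow_left₀ hδ h1 2).trans h2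
  rw [hellSq_comm]
  have h5 := mul_le_mul_of_nonneg_left h3 (hellSq_nonneg g f)
  unfold hellSq at h5 ⊢
  linarith

/-- If the densities `D p q` have the rectangle property in the inputs `p` and `q` of two players,
and single flips between inputs with one zero column have small effects, then so have the
simultaneous flips. -/
theorem hellSq_rectangle_le {τ : Type*} [Fintype τ] {D : Bool × Bool → Bool × Bool → τ → ℝ}
    (h0 : ∀ p q t, 0 ≤ D p q t) (h1 : ∀ p q, ∑ t, D p q t = 1)
    (hD : ∀ p q p' q' t, D p q t * D p' q' t = D p q' t * D p' q t) :
    hellSq (D (false, true) (true, false)) (D (true, true) (true, true))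
      ≤ 12 * (hellSq (D (false, true) (false, true)) (D (true, true) (false, true))
        + hellSq (D (false, true) (false, true)) (D (false, true) (true, true))
        + hellSq (D (true, false) (true, false)) (D (true, true) (true, false))
        + hellSq (D (true, false) (true, false)) (D (true, false) (true, true))) := by
  have cut : ∀ p q p' q', hellSq (D p q) (D p' q') = hellSq (D p q') (D p' q) := fun p q p' q' =>
    hellSq_eq_of_mul_eq (h0 _ _) (h0 _ _) (h0 _ _) (h0 _ _) (h1 _ _) (h1 _ _) (h1 _ _) (h1 _ _)
      (hD p q p' q')
  have n1 := hellSq_nonneg (D (false, true) (false, true)) (D (true, true) (false, true))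
  have n2 := hellSq_nonneg (D (false, true) (false, true)) (D (false, true) (true, true))
  have n3 := hellSq_nonneg (D (true, false) (true, false)) (D (true, true) (true, false))
  have n4 := hellSq_nonneg (D (true, false) (true, false)) (D (true, false) (true, true))
  have a1 := hellSq_triangle (D (false, true) (true, true)) (D (false, true) (false, true))
    (D (true, true) (false, true))
  rw [hellSq_comm (D (false, true) (true, true)) (D (false, true) (false, true)), cut] at a1
  have a2 := hellSq_triangle (D (false, true) (true, true)) (D (false, true) (false, true))
    (D (true, true) (true, true))
  rw [hellSq_comm (D (false, true) (true, true)) (D (false, true) (false, true))] at a2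
  have b1 := hellSq_triangle (D (true, false) (true, true)) (D (true, false) (true, false))
    (D (true, true) (true, false))
  rw [hellSq_comm (D (true, false) (true, true)) (D (true, false) (true, false)), cut] at b1
  have b2 := hellSq_triangle (D (true, true) (true, true)) (D (true, false) (true, false))
    (D (true, true) (true, false))
  rw [hellSq_comm (D (true, true) (true, true)) (D (true, false) (true, false))] at b2
  -- Cut and paste turns the target into a distance between two inputs each one flip away from all
  -- ones. Either leg costs at most 4 and 6 times the given flips, and the triangle inequality
  -- doubles this to 12.
  have c := hellSq_triangle (D (false, true) (true, true)) (D (true, true) (true, true))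
    (D (true, true) (true, false))
  rw [cut] at c
  linarith

/-! ### Tribes instances: one planted column, one other column, two players -/

namespace TranscriptLaw

variable {k m ℓ : ℕ}

/-- The kind of the cell of player `i` in column `b`, when `W` marks one all-one column in each
block and `Z` marks one player with a zero for each other column. -/
def cellKind (W : Fin m → Fin ℓ) (Z : Fin m × Fin ℓ → Fin k) (i : Fin k) (b : Fin m × Fin ℓ) :
    Option Bool :=
  if W b.1 = b.2 then some true else if Z b = i then some false else none

theorem cellKind_planted (W : Fin m → Fin ℓ) (Z : Fin m × Fin ℓ → Fin k) (i : Fin k) (a : Fin m) :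
    cellKind W Z i (a, W a) = some true := by simp [cellKind]

theorem cellKind_eq_none {W : Fin m → Fin ℓ} {Z : Fin m × Fin ℓ → Fin k} {i : Fin k}
    {b : Fin m × Fin ℓ} : cellKind W Z i b = none ↔ W b.1 ≠ b.2 ∧ Z b ≠ i := by
  unfold cellKind
  split_ifs <;> simp_all

variable {τ V : Type*} [Fintype τ] [Fintype V] [DecidableEq V] {N : ℕ}
  {L : TranscriptLaw k (Fin m × Fin ℓ) τ V}

/-- The inputs of two columns: `p` for player `i`, `q` for player `j`, ones for the others. -/
def twoRows (i j : Fin k) (p q : Bool × Bool) (l : Fin k) : Bool × Bool :=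
  if l = i then p else if l = j then q else (true, true)

theorem effect_cellKind {W : Fin m → Fin ℓ} {Z : Fin m × Fin ℓ → Fin k}
    (σ : Fin m × Fin ℓ ≃ Fin N) {a : Fin m} {β : Fin ℓ} (hβ : W a ≠ β) {i j : Fin k} (hij : i ≠ j)
    {y y' : Fin k → Bool × Bool} (hy : y = twoRows i j (false, true) (false, true))
    (hy' : y' = twoRows i j (true, true) (false, true)) (hZ : Z (a, β) = j) :
    L.effect (cellKind W Z) σ i (a, β) = fullExp (cellKind W Z) fun M x =>
      hellSq (L.mixed (pairBias (cellKind W Z) (earlier σ (a, β)) (a, β) (a, W a) y M x))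
        (L.mixed (pairBias (cellKind W Z) (earlier σ (a, β)) (a, β) (a, W a) y' M x)) := by
  subst hy hy'
  refine effect_eq_fullExp (cellKind W Z) σ (by simpa using hβ)
    (fun l => cellKind_planted W Z l a) (by simp [twoRows]) (by simp [twoRows])
    (fun l hl => by simp [twoRows, hl]) fun l hl => ?_
  by_cases hlj : l = j
  · subst hlj
    simp [twoRows, hl, cellKind, hβ, hZ, cellBias, bitReal]
  · simp [twoRows, hl, hlj, cellKind, hβ, hZ, Ne.symm hlj, cellBias, bitReal]

omit [Fintype V] [DecidableEq V] in
theorem fullExp_hellSq_congr {B : Type*} [Fintype B] [DecidableEq B] {L : TranscriptLaw k B τ V}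
    {kd kd' : Fin k → B → Option Bool} {S S' : Finset B}
    {b c b₁ c₁ : B} (hbc : b₁ = b ∧ c₁ = c)
    (hkd : ∀ l b', b' ≠ b → b' ≠ c → kd l b' = kd' l b')
    (hS : ∀ b', b' ≠ b → b' ≠ c → (b' ∈ S ↔ b' ∈ S')) (y y' : Fin k → Bool × Bool) :
    fullExp kd (fun M x => hellSq (L.mixed (pairBias kd S b₁ c₁ y M x))
        (L.mixed (pairBias kd S b₁ c₁ y' M x)))
      = fullExp kd' fun M x => hellSq (L.mixed (pairBias kd' S' b c y M x))
        (L.mixed (pairBias kd' S' b c y' M x)) := by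
  obtain ⟨rfl, rfl⟩ := hbc
  have e : ∀ y M x, pairBias kd S b₁ c₁ y M x = pairBias kd' S' b₁ c₁ y M x := by
    intro y M x
    funext l b'
    unfold pairBias
    split_ifs with h1 h2 h3 h4 h4
    · rfl
    · rfl
    · rw [hkd l b' h1 h2]
    · exact absurd ((hS b' h1 h2).1 h3) h4
    · exact absurd ((hS b' h1 h2).2 h4) h3
    · rfl
  simp_rw [e]
  refine fullExp_congr hkd fun M x M' x' hM hx => ?_
  have : ∀ y, pairBias kd' S' b₁ c₁ y M x = pairBias kd' S' b₁ c₁ y M' x' := by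
    intro y
    funext l b'
    unfold pairBias
    split_ifs with h1 h2 h3
    · rfl
    · rfl
    · rw [hM b' h1 h2]
    · rw [hx l b' h1 h2]
  simp_rw [this]

theorem pairBias_swap {B : Type*} [DecidableEq B] {kd : Fin k → B → Option Bool} {S : Finset B}
    {b c : B} (hbc : b ≠ c) (y : Fin k → Bool × Bool) (M : B → Bool) (x : Fin k → B → Bool) :
    pairBias kd S c b y M x = pairBias kd S b c (fun l => (y l).swap) M x := by
  funext l b'
  unfold pairBias
  by_cases h1 : b' = b
  · subst h1; simp [hbc]
  · by_cases h2 : b' = c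
    · subst h2; simp [h1]
    · simp [h1, h2]

/-- In the swapped order `c` takes the rank of `b`, so both flips see the same averaged columns off
the pair. This is why the order is later summed over as well. -/
theorem mem_earlier_swap {B : Type*} [Fintype B] [DecidableEq B] (σ : B ≃ Fin N) {b c b' : B}
    (hb : b' ≠ b) (hc : b' ≠ c) :
    b' ∈ earlier ((Equiv.swap b c).trans σ) c ↔ b' ∈ earlier σ b := by
  simp [earlier, Equiv.swap_apply_of_ne_of_ne hb hc]

/-- The value of `Tribes` with an uncurried column index. -/
def tribesValue (X : Fin k → Fin m × Fin ℓ → Bool) : Bool :=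
  decide (∀ a, ∃ j, ∀ i, X i (a, j) = true)

theorem bitReal_eq_of_bern_ne_zero {x y : Bool} (h : bern (bitReal x) y ≠ 0) : y = x := by
  rw [bern_bitReal] at h
  by_contra hne
  simp [pointMass, hne] at h

/-- In the first two effects `c` is planted and `b` has zeros at `i` and `j`; in the last two the
roles are exchanged. All four become expectations for the same kinds and the same set of averaged
columns, since the columns `b` and `c` are overwritten. The constant is 48 = 4 · 12. -/
theorem sq_le_sum_effect {W : Fin m → Fin ℓ} (Z : Fin m × Fin ℓ → Fin k)
    (σ : Fin m × Fin ℓ ≃ Fin N) {a : Fin m} {β : Fin ℓ} (hβ : W a ≠ β) {i j : Fin k} (hij : i ≠ j)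
    (ans : τ → Bool) {δ : ℝ} (hδ : 0 ≤ 1 - 2 * δ)
    (herr : ∀ X, ∑ t, L.prob X t * (if ans t = tribesValue X then 0 else 1) ≤ δ) :
    (1 - 2 * δ) ^ 2 ≤ 48 *
      (L.effect (cellKind W (Function.update Z (a, β) j)) σ i (a, β)
      + L.effect (cellKind W (Function.update Z (a, β) i)) σ j (a, β)
      + L.effect (cellKind (Function.update W a β) (Function.update Z (a, W a) j))
          ((Equiv.swap (a, β) (a, W a)).trans σ) i (a, W a)
      + L.effect (cellKind (Function.update W a β) (Function.update Z (a, W a) i))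
          ((Equiv.swap (a, β) (a, W a)).trans σ) j (a, W a)) := by
  set b : Fin m × Fin ℓ := (a, β) with hb
  set c : Fin m × Fin ℓ := (a, W a) with hc
  have hbc : b ≠ c := by simp [hb, hc, hβ.symm]
  set kd := cellKind W Z with hkd
  set S := earlier σ b with hS
  let D : (Fin m × Fin ℓ → Bool) → (Fin k → Fin m × Fin ℓ → Bool) →
      Bool × Bool → Bool × Bool → τ → ℝ := fun M x p q =>
    L.mixed (pairBias kd S b c (twoRows i j p q) M x)
  have hk1 : ∀ z l b', b' ≠ b → b' ≠ c →
      cellKind W (Function.update Z b z) l b' = kd l b' := by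
    intro z l b' h1 h2
    simp [cellKind, hkd, h1]
  have hW : ∀ b' : Fin m × Fin ℓ, b' ≠ b → b' ≠ c →
      (Function.update W a β b'.1 = b'.2 ↔ W b'.1 = b'.2) := by
    rintro ⟨a', β'⟩ h1 h2
    by_cases haa : a' = a
    · subst haa
      have h1' : β ≠ β' := fun h => h1 (by rw [hb, h])
      have h2' : W a' ≠ β' := fun h => h2 (by rw [hc, h])
      simp [h1', h2']
    · simp [haa]
  have hk2 : ∀ z l b', b' ≠ c → b' ≠ b →
      cellKind (Function.update W a β) (Function.update Z c z) l b' = kd l b' := by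
    intro z l b' h1 h2
    simp [cellKind, hkd, h1, hW b' h2 h1]
  have hcomm : ∀ p q, twoRows j i q p = twoRows i j p q := by
    intro p q
    funext l
    unfold twoRows
    by_cases h1 : l = i
    · subst h1; simp [hij]
    · simp [h1]
  have hswap : ∀ p q, (fun l => (twoRows i j p q l).swap) = twoRows i j p.swap q.swap := by
    intro p q
    funext l
    unfold twoRows
    split_ifs <;> rfl
  have e1 : L.effect (cellKind W (Function.update Z b j)) σ i b = fullExp kd fun M x =>
      hellSq (D M x (false, true) (false, true)) (D M x (true, true) (false, true)) := by
    rw [effect_cellKind σ hβ hij rfl rfl (by simp [hb])]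
    exact fullExp_hellSq_congr ⟨rfl, rfl⟩ (hk1 j) (fun _ _ _ => Iff.rfl) _ _
  have e2 : L.effect (cellKind W (Function.update Z b i)) σ j b = fullExp kd fun M x =>
      hellSq (D M x (false, true) (false, true)) (D M x (false, true) (true, true)) := by
    rw [effect_cellKind σ hβ hij.symm rfl rfl (by simp [hb])]
    rw [hcomm, hcomm]
    exact fullExp_hellSq_congr ⟨rfl, rfl⟩ (hk1 i) (fun _ _ _ => Iff.rfl) _ _
  have hβ' : Function.update W a β a ≠ W a := by simpa using hβ.symm
  have hbc' : c = c ∧ (a, Function.update W a β a) = b := by simp [hb]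
  have e3 : L.effect (cellKind (Function.update W a β) (Function.update Z c j))
      ((Equiv.swap b c).trans σ) i c = fullExp kd fun M x =>
      hellSq (D M x (true, false) (true, false)) (D M x (true, true) (true, false)) := by
    rw [effect_cellKind _ hβ' hij rfl rfl (by simp [hc])]
    rw [fullExp_hellSq_congr (kd' := kd) (S' := S) hbc' (hk2 j)
      (fun b' h1 h2 => mem_earlier_swap σ h2 h1) _ _]
    simp_rw [pairBias_swap hbc, hswap]
    rfl
  have e4 : L.effect (cellKind (Function.update W a β) (Function.update Z c i))
      ((Equiv.swap b c).trans σ) j c = fullExp kd fun M x =>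
      hellSq (D M x (true, false) (true, false)) (D M x (true, false) (true, true)) := by
    rw [effect_cellKind _ hβ' hij.symm rfl rfl (by simp [hc])]
    rw [hcomm, hcomm, fullExp_hellSq_congr (kd' := kd) (S' := S) hbc' (hk2 i)
      (fun b' h1 h2 => mem_earlier_swap σ h2 h1) _ _]
    simp_rw [pairBias_swap hbc, hswap]
    rfl
  rw [e1, e2, e3, e4]
  have hD0 : ∀ M x p q t, 0 ≤ D M x p q t := fun M x p q t =>
    mixed_nonneg (fun _ _ => pairBias_mem _ _ _ _ _ _ _ _ _) t
  have hD1 : ∀ M x p q, ∑ t, D M x p q t = 1 := fun M x p q => sum_mixed _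
  have hDrect : ∀ M x p q p' q' t, D M x p q t * D M x p' q' t = D M x p q' t * D M x p' q t := by
    intro M x p q p' q' t
    have : ∀ p q p' q', D M x p q t * D M x p' q' t = L.coord t * L.coord t * ∏ l,
        (L.rowFactor l (pairBias kd S b c (twoRows i j p q) M x l) (L.view l t) *
          L.rowFactor l (pairBias kd S b c (twoRows i j p' q') M x l) (L.view l t)) := by
      intro p q p' q'
      simp only [D, mixed]
      rw [Finset.prod_mul_distrib]
      ring
    rw [this, this]
    congr 1
    refine Finset.prod_congr rfl fun l _ => ?_
    have hrow : ∀ p q, pairBias kd S b c (twoRows i j p q) M x l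
        = pairBias kd S b c (fun _ => twoRows i j p q l) M x l := fun _ _ => rfl
    rw [hrow p q, hrow p' q', hrow p q', hrow p' q]
    by_cases h1 : l = i
    · simp [twoRows, h1]
    · by_cases h2 : l = j
      · simp only [twoRows, h2, hij.symm, if_true, if_false]; ring
      · simp [twoRows, h1, h2]
  have hpoint : ∀ M x, (∀ l b', bern (cellBias (kd l b') (M b')) (x l b') ≠ 0) →
      (1 - 2 * δ) ^ 2 ≤ 4 * hellSq (D M x (false, true) (true, false))
        (D M x (true, true) (true, true)) := by
    intro M x hx
    have hplant : ∀ l a', cellBias (kd l (a', W a')) (M (a', W a')) = 1 ∧ x l (a', W a') = true := by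
      intro l a'
      have h := hx l (a', W a')
      rw [hkd, cellKind_planted] at h ⊢
      exact ⟨by simp [cellBias, bitReal], bitReal_eq_of_bern_ne_zero h⟩
    have hmark : ∀ b', W b'.1 ≠ b'.2 → cellBias (kd (Z b') b') (M b') = 0 ∧ x (Z b') b' = false := by
      intro b' hb'
      have h := hx (Z b') b'
      have hk : kd (Z b') b' = some false := by simp [hkd, cellKind, hb']
      rw [hk] at h ⊢
      exact ⟨by simp [cellBias, bitReal], bitReal_eq_of_bern_ne_zero h⟩
    refine sq_le_four_mul_hellSq (hD0 M x _ _) (hD0 M x _ _) (hD1 M x _ _) (hD1 M x _ _) ans hδ ?_ ?_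
    · refine sum_mixed_mul_le (fun _ _ => pairBias_mem _ _ _ _ _ _ _ _ _) _ fun X hX => ?_
      -- In block `a`, column `b` has a zero at `i`, column `c` one at `j`, and every other column
      -- its marked zero.
      have hval : tribesValue X = false := by
        simp only [tribesValue, decide_eq_false_iff_not, not_forall, not_exists]
        refine ⟨a, fun β' => ?_⟩
        have hzero : ∀ l b', pairBias kd S b c (twoRows i j (false, true) (true, false)) M x l b' = 0 →
            ¬X l b' = true := by
          intro l b' h0 h1
          have := hX l b'
          simp [h0, h1, bern] at this
        by_cases h1 : β' = β
        · subst h1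
          exact ⟨i, hzero _ _ (by simp [pairBias, hb, twoRows, bitReal])⟩
        · by_cases h2 : β' = W a
          · subst h2
            exact ⟨j, hzero _ _ (by
              simp [pairBias, hc, hb, twoRows, bitReal, hβ, hij.symm])⟩
          · refine ⟨Z (a, β'), hzero _ _ ?_⟩
            have := hmark (a, β') (by simpa using Ne.symm h2)
            simp [pairBias, hb, hc, h1, h2, this.1, this.2, bitReal]
      simpa [hval] using herr X
    · refine sum_mixed_mul_le (fun _ _ => pairBias_mem _ _ _ _ _ _ _ _ _) _ fun X hX => ?_
      -- Planted columns are all ones; in block `a` the planted column belongs to the overwritten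
      -- pair, which is all ones too.
      have hval : tribesValue X = true := by
        simp only [tribesValue, decide_eq_true_eq]
        intro a'
        have hone : ∀ l b', pairBias kd S b c (twoRows i j (true, true) (true, true)) M x l b' = 1 →
            X l b' = true := by
          intro l b' h0
          have := hX l b'
          by_contra h1
          simp only [Bool.not_eq_true] at h1
          simp [h0, h1, bern] at this
        refine ⟨W a', fun l => hone _ _ ?_⟩
        have := hplant l a'
        unfold pairBias
        split_ifs
        · simp [twoRows, bitReal]
        · simp [twoRows, bitReal]
        · exact this.1
        · simp [this.2, bitReal]
      simpa [hval] using herr X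
  have hfin := fullExp_mono_of_ne_zero (kd := kd) (g := fun _ _ => (1 - 2 * δ) ^ 2) fun M x hx =>
    (hpoint M x hx).trans (mul_le_mul_of_nonneg_left
      (hellSq_rectangle_le (hD0 M x) (hD1 M x) (hDrect M x)) (by norm_num : (0 : ℝ) ≤ 4))
  have hconst : fullExp kd (fun _ _ => (1 - 2 * δ) ^ 2) = (1 - 2 * δ) ^ 2 :=
    prodSum_const (sum_fullWeight kd) _
  rw [hconst] at hfin
  refine hfin.trans (le_of_eq ?_)
  unfold fullExp
  rw [prodSum_const_mul, prodSum_const_mul, prodSum_add, prodSum_add, prodSum_add]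
  ring

end TranscriptLaw

/-! ### Averaging over planted columns, marked players and orders -/

section Sums

variable {ι α : Type*} [Fintype ι] [DecidableEq ι] [Fintype α]

/-- Exchanging the value `f i` with `a` is an involution; it will trade the planted column for
another one. -/
theorem sum_update_swap (i : ι) (F : (ι → α) → α → ℝ) :
    ∑ f, ∑ a, F (Function.update f i a) (f i) = ∑ f, ∑ a, F f a := by
  rw [← Fintype.sum_prod_type', ← Fintype.sum_prod_type']
  have h : Function.Involutive fun p : (ι → α) × α => (Function.update p.1 i p.2, p.1 i) := by
    rintro ⟨f, a⟩
    simp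
  exact Equiv.sum_comp h.toPerm fun p : (ι → α) × α => F p.1 p.2

theorem sum_update (i : ι) (F : (ι → α) → ℝ) :
    ∑ f, ∑ a, F (Function.update f i a) = Fintype.card α * ∑ f, F f := by
  rw [sum_update_swap i fun f _ => F f, Finset.mul_sum]
  simp

end Sums

theorem sum_ite_ne {α : Type*} [Fintype α] [DecidableEq α] (a : α) :
    ∑ b, (if a ≠ b then (1 : ℝ) else 0) = Fintype.card α - 1 := by
  have : ∀ b, (if a ≠ b then (1 : ℝ) else 0) = 1 - if a = b then 1 else 0 := fun b => by
    split_ifs <;> simp_all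
  simp [this]

namespace TranscriptLaw

variable {k m ℓ : ℕ} {τ V : Type*} [Fintype τ] [Fintype V] [DecidableEq V]

theorem effect_nonneg {B : Type*} [Fintype B] [DecidableEq B] {N : ℕ} {L : TranscriptLaw k B τ V}
    (kd : Fin k → B → Option Bool) (σ : B ≃ Fin N) (i : Fin k) (b : B) :
    0 ≤ L.effect kd σ i b :=
  rowExp_nonneg fun _ => Finset.sum_nonneg fun _ _ =>
    mul_nonneg (restFactor_nonneg _ _ _ _) (sq_nonneg _)

/-- A protocol for `Tribes` has long views. -/
theorem tribes_le_sum_len {L : TranscriptLaw k (Fin m × Fin ℓ) τ V} (hk : 1 ≤ k) (hℓ : 1 ≤ ℓ)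
    (ans : τ → Bool) {δ : ℝ} (hδ : 0 ≤ 1 - 2 * δ)
    (herr : ∀ X, ∑ t, L.prob X t * (if ans t = tribesValue X then 0 else 1) ≤ δ)
    {len : V → ℝ} (hlen : ∑ v, Real.exp (-len v) ≤ 1)
    {Λ : ℝ} (hΛ : ∀ t, ∑ i, len (L.view i t) ≤ Λ) :
    m * (ℓ - 1 : ℝ) * (k - 1) * (1 - 2 * δ) ^ 2 ≤ 11520 * Λ := by
  set N := Fintype.card (Fin m × Fin ℓ)
  set g : (Fin m → Fin ℓ) → (Fin m × Fin ℓ → Fin k) → (Fin m × Fin ℓ ≃ Fin N) → Fin k →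
      Fin m × Fin ℓ → ℝ := fun W Z σ i b =>
    if cellKind W Z i b = none then L.effect (cellKind W Z) σ i b else 0 with hg
  have hg0 : ∀ W Z σ i b, 0 ≤ g W Z σ i b := fun W Z σ i b => by
    simp only [hg]; split_ifs
    exacts [effect_nonneg _ _ _ _, le_rfl]
  set ε := (1 - 2 * δ) ^ 2
  have hkey : ∀ a W β σ Z i j, (if W a ≠ β then (1 : ℝ) else 0) * (if i ≠ j then (1 : ℝ) else 0) * ε
      ≤ 48 * (g W (Function.update Z (a, β) j) σ i (a, β)
        + g W (Function.update Z (a, β) i) σ j (a, β)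
        + g (Function.update W a β) (Function.update Z (a, W a) j)
          ((Equiv.swap (a, β) (a, W a)).trans σ) i (a, W a)
        + g (Function.update W a β) (Function.update Z (a, W a) i)
          ((Equiv.swap (a, β) (a, W a)).trans σ) j (a, W a)) := by
    intro a W β σ Z i j
    by_cases hβ : W a ≠ β
    · by_cases hij : i ≠ j
      · have h := sq_le_sum_effect (L := L) Z σ hβ hij ans hδ herr
        have hk1 : ∀ {i j : Fin k}, i ≠ j → cellKind W (Function.update Z (a, β) j) i (a, β) = none :=
          fun hij => cellKind_eq_none.2 ⟨hβ, by simpa using hij.symm⟩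
        have hk2 : ∀ {i j : Fin k}, i ≠ j → cellKind (Function.update W a β)
            (Function.update Z (a, W a) j) i (a, W a) = none :=
          fun hij => cellKind_eq_none.2 ⟨by simpa using hβ.symm, by simpa using hij.symm⟩
        simpa only [hg, hk1 hij, hk1 hij.symm, hk2 hij, hk2 hij.symm, if_true, if_pos hβ, if_pos hij,
          one_mul] using h
      · rw [if_neg hij, mul_zero, zero_mul]
        have := hg0 W (Function.update Z (a, β) j) σ i (a, β)
        have := hg0 W (Function.update Z (a, β) i) σ j (a, β)
        have := hg0 (Function.update W a β) (Function.update Z (a, W a) j)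
          ((Equiv.swap (a, β) (a, W a)).trans σ) i (a, W a)
        have := hg0 (Function.update W a β) (Function.update Z (a, W a) i)
          ((Equiv.swap (a, β) (a, W a)).trans σ) j (a, W a)
        positivity
    · rw [if_neg hβ, zero_mul, zero_mul]
      have := hg0 W (Function.update Z (a, β) j) σ i (a, β)
      have := hg0 W (Function.update Z (a, β) i) σ j (a, β)
      have := hg0 (Function.update W a β) (Function.update Z (a, W a) j)
        ((Equiv.swap (a, β) (a, W a)).trans σ) i (a, W a)
      have := hg0 (Function.update W a β) (Function.update Z (a, W a) i)
        ((Equiv.swap (a, β) (a, W a)).trans σ) j (a, W a)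
      positivity
  have hsum := Finset.sum_le_sum fun a (_ : a ∈ Finset.univ) =>
    Finset.sum_le_sum fun W (_ : W ∈ Finset.univ) => Finset.sum_le_sum fun β (_ : β ∈ Finset.univ) =>
    Finset.sum_le_sum fun σ (_ : σ ∈ Finset.univ) => Finset.sum_le_sum fun Z (_ : Z ∈ Finset.univ) =>
    Finset.sum_le_sum fun i (_ : i ∈ Finset.univ) => Finset.sum_le_sum fun j (_ : j ∈ Finset.univ) =>
    hkey a W β σ Z i j
  have hL : ∑ a : Fin m, ∑ W : Fin m → Fin ℓ, ∑ β, ∑ _σ : Fin m × Fin ℓ ≃ Fin N,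
      ∑ _Z : Fin m × Fin ℓ → Fin k, ∑ i : Fin k, ∑ j : Fin k,
        (if W a ≠ β then (1 : ℝ) else 0) * (if i ≠ j then (1 : ℝ) else 0) * ε
      = m * (Fintype.card (Fin m → Fin ℓ) * ((ℓ - 1) * (Fintype.card (Fin m × Fin ℓ ≃ Fin N) *
        (Fintype.card (Fin m × Fin ℓ → Fin k) * (k * (k - 1) * ε))))) := by
    simp_rw [← Finset.sum_mul, ← Finset.mul_sum, sum_ite_ne, Finset.sum_const, Finset.card_univ,
      nsmul_eq_mul, mul_assoc, ← Finset.sum_mul, sum_ite_ne, Finset.sum_const, Finset.card_univ,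
      Fintype.card_fin, nsmul_eq_mul]
    ring
  replace hsum := le_of_eq_of_le hL.symm hsum
  -- The overwritten mark runs over all players, so each marking is counted `k` times.
  have hZ1 : ∀ (b : Fin m × Fin ℓ) (G : (Fin m × Fin ℓ → Fin k) → Fin k → ℝ),
      ∑ Z, ∑ i, ∑ j, G (Function.update Z b j) i = k * ∑ Z, ∑ i, G Z i := by
    intro b G
    rw [Finset.sum_comm, Finset.sum_comm (f := fun Z i => G Z i), Finset.mul_sum]
    refine Finset.sum_congr rfl fun i _ => ?_
    rw [sum_update b fun Z => G Z i, Fintype.card_fin]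
  have hZ2 : ∀ (b : Fin m × Fin ℓ) (G : (Fin m × Fin ℓ → Fin k) → Fin k → ℝ),
      ∑ Z, ∑ i, ∑ j, G (Function.update Z b i) j = k * ∑ Z, ∑ i, G Z i := by
    intro b G
    rw [← hZ1 b G]
    exact Finset.sum_congr rfl fun Z _ => Finset.sum_comm
  have hσ : ∀ (b c : Fin m × Fin ℓ) (G : (Fin m × Fin ℓ ≃ Fin N) → ℝ),
      ∑ σ : Fin m × Fin ℓ ≃ Fin N, G ((Equiv.swap b c).trans σ) = ∑ σ, G σ := by
    intro b c G
    have h : Function.Involutive fun σ : Fin m × Fin ℓ ≃ Fin N => (Equiv.swap b c).trans σ := by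
      intro σ
      ext x
      simp
    exact Equiv.sum_comp h.toPerm G
  set T := ∑ a, ∑ W, ∑ β, ∑ σ, ∑ Z, ∑ i, g W Z σ i (a, β) with hT
  -- Trading `W a` for `β` while swapping both columns in `σ` is a bijection, so the last two
  -- effects have the same totals as the first two.
  have hswap : ∑ a, ∑ W : Fin m → Fin ℓ, ∑ β, ∑ σ : Fin m × Fin ℓ ≃ Fin N, ∑ Z, ∑ i,
      g (Function.update W a β) Z ((Equiv.swap (a, β) (a, W a)).trans σ) i (a, W a) = T := by
    refine Finset.sum_congr rfl fun a _ => ?_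
    rw [← sum_update_swap a fun W β => ∑ σ, ∑ Z, ∑ i, g W Z σ i (a, β)]
    refine Finset.sum_congr rfl fun W _ => Finset.sum_congr rfl fun β _ => ?_
    exact hσ (a, β) (a, W a) fun σ => ∑ Z, ∑ i, g (Function.update W a β) Z σ i (a, W a)
  have hR : ∀ a W β σ, ∑ Z, ∑ i, ∑ j, 48 * (g W (Function.update Z (a, β) j) σ i (a, β)
        + g W (Function.update Z (a, β) i) σ j (a, β)
        + g (Function.update W a β) (Function.update Z (a, W a) j)
          ((Equiv.swap (a, β) (a, W a)).trans σ) i (a, W a)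
        + g (Function.update W a β) (Function.update Z (a, W a) i)
          ((Equiv.swap (a, β) (a, W a)).trans σ) j (a, W a))
      = 96 * k * (∑ Z, ∑ i, g W Z σ i (a, β) + ∑ Z, ∑ i, g (Function.update W a β) Z
          ((Equiv.swap (a, β) (a, W a)).trans σ) i (a, W a)) := by
    intro a W β σ
    simp_rw [← Finset.mul_sum, Finset.sum_add_distrib]
    rw [hZ1 (a, β) fun Z i => g W Z σ i (a, β), hZ2 (a, β) fun Z i => g W Z σ i (a, β),
      hZ1 (a, W a) fun Z i => g (Function.update W a β) Z
          ((Equiv.swap (a, β) (a, W a)).trans σ) i (a, W a),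
      hZ2 (a, W a) fun Z i => g (Function.update W a β) Z
          ((Equiv.swap (a, β) (a, W a)).trans σ) i (a, W a)]
    ring
  simp_rw [hR, ← Finset.mul_sum, Finset.sum_add_distrib] at hsum
  rw [hswap, ← hT] at hsum
  have hTle : T ≤ Fintype.card (Fin m → Fin ℓ) * (Fintype.card (Fin m × Fin ℓ ≃ Fin N) *
      (Fintype.card (Fin m × Fin ℓ → Fin k) * (60 * Λ))) := by
    rw [hT, Finset.sum_comm]
    have : ∀ W : Fin m → Fin ℓ, ∑ a, ∑ β, ∑ σ, ∑ Z, ∑ i, g W Z σ i (a, β)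
        = ∑ σ, ∑ Z, ∑ i, ∑ b, g W Z σ i b := by
      intro W
      rw [← Fintype.sum_prod_type' fun a β => ∑ σ, ∑ Z, ∑ i, g W Z σ i (a, β), Finset.sum_comm]
      refine Finset.sum_congr rfl fun σ _ => ?_
      rw [Finset.sum_comm]
      exact Finset.sum_congr rfl fun Z _ => Finset.sum_comm
    simp_rw [this]
    refine (Finset.sum_le_sum fun W _ => Finset.sum_le_sum fun σ _ => Finset.sum_le_sum fun Z _ =>
      sum_effect_le (L := L) (cellKind W Z) σ hlen hΛ).trans (le_of_eq ?_)
    simp only [Finset.sum_const, Finset.card_univ, nsmul_eq_mul]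
  have hc1 : (0 : ℝ) < Fintype.card (Fin m → Fin ℓ) := by
    have : Nonempty (Fin ℓ) := ⟨⟨0, hℓ⟩⟩
    exact_mod_cast Fintype.card_pos
  have hc2 : (0 : ℝ) < Fintype.card (Fin m × Fin ℓ ≃ Fin N) := by
    have : Nonempty (Fin m × Fin ℓ ≃ Fin N) := ⟨Fintype.equivFin _⟩
    exact_mod_cast Fintype.card_pos
  have hc3 : (0 : ℝ) < Fintype.card (Fin m × Fin ℓ → Fin k) := by
    have : Nonempty (Fin k) := ⟨⟨0, hk⟩⟩
    exact_mod_cast Fintype.card_pos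
  have hk0 : (0 : ℝ) < k := by exact_mod_cast hk
  set c1 : ℝ := (Fintype.card (Fin m → Fin ℓ) : ℝ)
  set c2 : ℝ := (Fintype.card (Fin m × Fin ℓ ≃ Fin N) : ℝ)
  set c3 : ℝ := (Fintype.card (Fin m × Fin ℓ → Fin k) : ℝ)
  have hpos : 0 < c1 * c2 * c3 * k := by positivity
  -- Four totals, each `k * T`, times 48 give `192 * k * T`; with `60 * Λ` per instance this is
  -- 11520.
  have hfin : (c1 * c2 * c3 * k) * (m * (ℓ - 1 : ℝ) * (k - 1) * ε) ≤
      (c1 * c2 * c3 * k) * (11520 * Λ) := by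
    have h2 := mul_le_mul_of_nonneg_left hTle (by positivity : (0 : ℝ) ≤ 192 * k)
    nlinarith [hsum, h2]
  exact le_of_mul_le_mul_left hfin hpos

end TranscriptLaw

/-! ### Finite sets of bounded lists -/

/-- Lists of length at most `T`. -/
abbrev BoundedList (α : Type*) (T : ℕ) := {l : List α // l.length ≤ T}

noncomputable instance {α : Type*} [Finite α] (T : ℕ) : Fintype (BoundedList α T) :=
  (List.finite_length_le α T).fintype

/-- Kraft's inequality: at most `4 ^ n` views have length `n`, contributing at most `2 ^ (-n) / 8`.
Without the extra 1 in the length the resulting bound would approach 2. -/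
theorem sum_exp_neg_length_le (T : ℕ) :
    ∑ v : BoundedList (Bool × Bool) T, Real.exp (-((v.1.length + 1) * Real.log 8)) ≤ 1 := by
  classical
  have hexp : ∀ n : ℕ, Real.exp (-((n + 1) * Real.log 8)) = (1 / 8) ^ (n + 1) := by
    intro n
    rw [← mul_neg, ← Real.log_inv, ← Nat.cast_succ, Real.exp_nat_mul, Real.exp_log (by norm_num)]
    norm_num
  simp_rw [hexp]
  have hcard : ∀ n : ℕ, ((Finset.univ.filter fun v : BoundedList (Bool × Bool) T =>
      v.1.length = n).card : ℝ) ≤ 4 ^ n := by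
    intro n
    have h : (Finset.univ.filter fun v : BoundedList (Bool × Bool) T => v.1.length = n).card
        ≤ Fintype.card (List.Vector (Bool × Bool) n) := by
      rw [← Fintype.card_subtype]
      exact Fintype.card_le_of_injective (fun v => (⟨v.1.1, v.2⟩ : List.Vector (Bool × Bool) n))
        fun v w h => Subtype.ext (Subtype.ext
          (congrArg (Subtype.val : List.Vector (Bool × Bool) n → List (Bool × Bool)) h :))
    rw [card_vector] at h
    have h4 : Fintype.card (Bool × Bool) = 4 := rfl
    rw [h4] at h
    exact_mod_cast h
  rw [← Finset.sum_fiberwise_of_maps_to (s := Finset.univ) (t := Finset.range (T + 1))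
    (g := fun v : BoundedList (Bool × Bool) T => v.1.length)
    fun v _ => Finset.mem_range.2 (Nat.lt_succ_of_le v.2)]
  calc _ ≤ ∑ n ∈ Finset.range (T + 1), (1 / 8 : ℝ) * (1 / 2) ^ n := by
        refine Finset.sum_le_sum fun n _ => ?_
        rw [Finset.sum_congr rfl fun v hv => by rw [(Finset.mem_filter.1 hv).2],
          Finset.sum_const, nsmul_eq_mul]
        refine (mul_le_mul_of_nonneg_right (hcard n) (by positivity)).trans (le_of_eq ?_)
        rw [pow_succ, ← mul_assoc, ← mul_pow, mul_comm]
        norm_num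
    _ ≤ 1 := by
        rw [← Finset.mul_sum, geom_sum_eq (by norm_num)]
        have : (0 : ℝ) ≤ (1 / 2) ^ (T + 1) := by positivity
        have e : (1 / 8 : ℝ) * (((1 / 2) ^ (T + 1) - 1) / (1 / 2 - 1))
            = (1 - (1 / 2) ^ (T + 1)) / 4 := by ring
        rw [e]
        linarith

/-! ### The transcript law of a protocol -/

instance {k : ℕ} : Finite (ChannelBit k) :=
  Finite.of_injective (fun e : ChannelBit k => (e.channel, e.fromPlayer, e.bit)) (by
    rintro ⟨⟩ ⟨⟩ h
    simpa using h)

namespace StarProtocol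

variable {k : ℕ} {X : Type} (P : StarProtocol k X)

/-- The coordinator's coins `ρ` are consistent with the message `e` after the history `h`. -/
def CoordStep (ρ : P.CoordCoins) (h : List (ChannelBit k)) (e : ChannelBit k) : Prop :=
  P.next ρ h = if e.fromPlayer then .receive e.channel else .send e.channel e.bit

/-- The coordinator's coins `ρ` are consistent with the history `h`. -/
def CoordOK (ρ : P.CoordCoins) (h : List (ChannelBit k)) : Prop :=
  ∀ h' e, h' ++ [e] <+: h → P.CoordStep ρ h' e

/-- The coins `ρ` of player `i` are consistent with the view `v` on input `x`. -/
def PlayerOK (i : Fin k) (x : X) (ρ : P.PlayerCoins i) (v : List (ChannelBit k)) : Prop :=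
  ∀ v' e, v' ++ [e] <+: v → e.fromPlayer = true → P.reply i x ρ v' = e.bit

variable {P}

theorem coordOK_nil (ρ : P.CoordCoins) : P.CoordOK ρ [] := by
  intro h' e h
  simp at h

theorem playerOK_nil (i : Fin k) (x : X) (ρ : P.PlayerCoins i) : P.PlayerOK i x ρ [] := by
  intro h' e h
  simp at h

theorem coordOK_concat {ρ : P.CoordCoins} {h : List (ChannelBit k)} {e : ChannelBit k} :
    P.CoordOK ρ (h ++ [e]) ↔ P.CoordOK ρ h ∧ P.CoordStep ρ h e := by
  constructor
  · intro H
    exact ⟨fun h' e' hp => H h' e' (hp.trans (List.prefix_append _ _)), H h e List.prefix_rfl⟩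
  · rintro ⟨H, He⟩ h' e' hp
    rcases List.prefix_concat_iff.1 hp with heq | hp
    · obtain ⟨rfl, h2⟩ := List.append_inj' heq rfl
      obtain rfl : e' = e := by simpa using h2
      exact He
    · exact H h' e' hp

theorem playerOK_concat {i : Fin k} {x : X} {ρ : P.PlayerCoins i} {v : List (ChannelBit k)}
    {e : ChannelBit k} :
    P.PlayerOK i x ρ (v ++ [e]) ↔
      P.PlayerOK i x ρ v ∧ (e.fromPlayer = true → P.reply i x ρ v = e.bit) := by
  constructor
  · intro H
    exact ⟨fun h' e' hp => H h' e' (hp.trans (List.prefix_append _ _)), H v e List.prefix_rfl⟩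
  · rintro ⟨H, He⟩ h' e' hp
    rcases List.prefix_concat_iff.1 hp with heq | hp
    · obtain ⟨rfl, h2⟩ := List.append_inj' heq rfl
      obtain rfl : e' = e := by simpa using h2
      exact He
    · exact H h' e' hp

theorem view_concat (i : Fin k) (h : List (ChannelBit k)) (e : ChannelBit k) :
    view i (h ++ [e]) = if e.channel = i then view i h ++ [e] else view i h := by
  unfold view
  split_ifs with hc <;> simp [hc]

theorem exists_history_concat {x : Fin k → X} {r : P.Coins} {h : List (ChannelBit k)}
    {e : ChannelBit k} :
    (∃ t, P.history x r t = h ++ [e]) ↔ (∃ t, P.history x r t = h) ∧ P.CoordStep r.1 h e ∧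
      (e.fromPlayer = true →
        P.reply e.channel (x e.channel) (r.2 e.channel) (view e.channel h) = e.bit) := by
  constructor
  · rintro ⟨t, ht⟩
    induction t with
    | zero => simp [history] at ht
    | succ t ih =>
      rw [history, step] at ht
      split at ht
      · next i b hn =>
        obtain ⟨h1, h2⟩ := List.append_inj' ht rfl
        obtain rfl : _ = e := by simpa using h2
        rw [h1] at hn
        exact ⟨⟨t, h1⟩, by simp [CoordStep, hn], by simp⟩
      · next i hn =>
        obtain ⟨h1, h2⟩ := List.append_inj' ht rfl
        obtain rfl : _ = e := by simpa using h2
        rw [h1] at hn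
        exact ⟨⟨t, h1⟩, by simp [CoordStep, hn], by simp [h1]⟩
      · exact ih ht
  · rintro ⟨⟨t, ht⟩, hc, hp⟩
    refine ⟨t + 1, ?_⟩
    rw [history, step, ht, hc]
    rcases e with ⟨i, fp, b⟩
    cases fp
    · simp
    · simpa using hp

/-- The rectangle property: the coins which lead to a given history form a product set. -/
theorem exists_history_eq_iff {x : Fin k → X} {r : P.Coins} {h : List (ChannelBit k)} :
    (∃ t, P.history x r t = h) ↔
      P.CoordOK r.1 h ∧ ∀ i, P.PlayerOK i (x i) (r.2 i) (view i h) := by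
  induction h using List.reverseRecOn with
  | nil => exact ⟨fun _ => ⟨coordOK_nil _, fun i => playerOK_nil _ _ _⟩, fun _ => ⟨0, rfl⟩⟩
  | append_singleton h e ih =>
    rw [exists_history_concat, ih, coordOK_concat]
    constructor
    · rintro ⟨⟨h1, h2⟩, h3, h4⟩
      refine ⟨⟨h1, h3⟩, fun i => ?_⟩
      rw [view_concat]
      split_ifs with hc
      · subst hc
        exact playerOK_concat.2 ⟨h2 _, h4⟩
      · exact h2 i
    · rintro ⟨⟨h1, h3⟩, h2⟩
      refine ⟨⟨h1, fun i => ?_⟩, h3, ?_⟩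
      · have := h2 i
        rw [view_concat] at this
        split_ifs at this with hc
        · exact (playerOK_concat.1 this).1
        · exact this
      · have := h2 e.channel
        rw [view_concat, if_pos rfl] at this
        exact (playerOK_concat.1 this).2

theorem history_eq_of_output {x : Fin k → X} {r : P.Coins} {t : ℕ} {b : Bool}
    (h : P.next r.1 (P.history x r t) = .output b) {s : ℕ} (hs : t ≤ s) :
    P.history x r s = P.history x r t := by
  induction s, hs using Nat.le_induction with
  | base => rfl
  | succ s _ ih => rw [history, step, ih, h]

theorem history_length_le {T : ℕ} (hT : P.cost ≤ T) (x : Fin k → X) (r : P.Coins) (t : ℕ) :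
    (P.history x r t).length ≤ T := by
  have h1 : ((P.history x r t).length : ℕ∞) ≤ P.cost :=
    (le_iSup (fun t => ((P.history x r t).length : ℕ∞)) t).trans
      ((le_iSup (fun r => P.bits x r) r).trans (le_iSup (fun x => ⨆ r, P.bits x r) x))
  exact_mod_cast h1.trans hT

/-- Every step before stopping sends a bit, so a run still going after `T` steps would exceed the
cost. -/
theorem exists_output {T : ℕ} (hT : P.cost ≤ T) (x : Fin k → X) (r : P.Coins) :
    ∃ b, P.next r.1 (P.history x r T) = .output b := by
  by_contra hno
  push Not at hno
  have hgrow : ∀ t, t ≤ T + 1 → (P.history x r t).length = t := by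
    intro t
    induction t with
    | zero => intro _; rfl
    | succ t ih =>
      intro ht
      have hn : ∀ b, P.next r.1 (P.history x r t) ≠ .output b := fun b hb => by
        have := history_eq_of_output hb (Nat.le_of_succ_le_succ ht)
        exact hno b (this ▸ hb)
      rw [history, step]
      split
      · rw [List.length_append, ih (by omega)]; rfl
      · rw [List.length_append, ih (by omega)]; rfl
      · next b hb => exact absurd hb (hn b)
  have := history_length_le hT x r (T + 1)
  rw [hgrow (T + 1) le_rfl] at this
  omega

/-- A history at which the coordinator stops is the final one; this makes the end events disjoint.
-/
theorem history_eq_of_exists {T : ℕ} (hT : P.cost ≤ T) {x : Fin k → X} {r : P.Coins}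
    {h : List (ChannelBit k)} {b : Bool} (hh : ∃ t, P.history x r t = h)
    (hb : P.next r.1 h = .output b) : P.history x r T = h := by
  obtain ⟨t, rfl⟩ := hh
  obtain ⟨b', hb'⟩ := exists_output hT x r
  rcases le_total t T with hle | hle
  · exact history_eq_of_output hb hle
  · exact (history_eq_of_output hb' hle).symm

theorem measurableSet_coordOK (h : List (ChannelBit k)) : MeasurableSet {ρ | P.CoordOK ρ h} := by
  induction h using List.reverseRecOn with
  | nil => simp [coordOK_nil]
  | append_singleton h e ih =>
    simp_rw [coordOK_concat]
    exact ih.inter (P.measurable_next h _)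

theorem measurableSet_playerOK (i : Fin k) (x : X) (v : List (ChannelBit k)) :
    MeasurableSet {ρ | P.PlayerOK i x ρ v} := by
  induction v using List.reverseRecOn with
  | nil => simp [playerOK_nil]
  | append_singleton v e ih =>
    simp_rw [playerOK_concat]
    have h : MeasurableSet {ρ | e.fromPlayer = true → P.reply i x ρ v = e.bit} := by
      by_cases hc : e.fromPlayer = true
      · simp only [hc, true_imp_iff]
        exact P.measurable_reply i x v e.bit
      · simp [hc]
    exact ih.inter h

variable (P)

/-- The coins for which the execution on inputs `x` ends with history `h` and answer `b`. -/
def endEvent (x : Fin k → X) (h : List (ChannelBit k)) (b : Bool) : Set P.Coins :=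
  {ρ | P.CoordOK ρ h ∧ P.next ρ h = .output b} ×ˢ
    Set.univ.pi fun i => {ρ | P.PlayerOK i (x i) ρ (view i h)}

variable {P}

theorem mem_endEvent {x : Fin k → X} {h : List (ChannelBit k)} {b : Bool} {r : P.Coins} :
    r ∈ P.endEvent x h b ↔ (∃ t, P.history x r t = h) ∧ P.next r.1 h = .output b := by
  rw [exists_history_eq_iff]
  simp only [endEvent, Set.mem_prod, Set.mem_ofPred_eq, Set.mem_univ_pi]
  tauto

theorem measurableSet_endEvent (x : Fin k → X) (h : List (ChannelBit k)) (b : Bool) :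
    MeasurableSet (P.endEvent x h b) :=
  ((measurableSet_coordOK h).inter (P.measurable_next h _)).prod
    (MeasurableSet.univ_pi fun i => measurableSet_playerOK i (x i) _)

instance : IsProbabilityMeasure P.coinLaw := by unfold coinLaw; infer_instance

theorem coinLaw_endEvent (x : Fin k → X) (h : List (ChannelBit k)) (b : Bool) :
    P.coinLaw.real (P.endEvent x h b)
      = P.coordLaw.real {ρ | P.CoordOK ρ h ∧ P.next ρ h = .output b} *
        ∏ i, (P.playerLaw i).real {ρ | P.PlayerOK i (x i) ρ (view i h)} := by
  simp only [coinLaw, endEvent, Measure.real, Measure.prod_prod, Measure.pi_pi, ENNReal.toReal_mul,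
    ENNReal.toReal_prod]

/-- A view as a list of bits and directions. -/
def stripChannel (v : List (ChannelBit k)) : List (Bool × Bool) := v.map fun e => (e.fromPlayer, e.bit)

/-- A list of directions and bits as a list of messages over channel `i`. -/
def addChannel (i : Fin k) (v : List (Bool × Bool)) : List (ChannelBit k) :=
  v.map fun p => ⟨i, p.1, p.2⟩

theorem addChannel_stripChannel_view (i : Fin k) (h : List (ChannelBit k)) :
    addChannel i (stripChannel (view i h)) = view i h := by
  unfold addChannel stripChannel view
  rw [List.map_map]
  conv_rhs => rw [← List.map_id (h.filter _)]
  refine List.map_congr_left fun e he => ?_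
  have : e.channel = i := by simpa using (List.mem_filter.1 he).2
  subst this
  rfl

theorem sum_length_view (h : List (ChannelBit k)) : ∑ i, (view i h).length = h.length := by
  induction h using List.reverseRecOn with
  | nil => simp [view]
  | append_singleton h e ih =>
    have : ∀ i, (view i (h ++ [e])).length = (view i h).length + if e.channel = i then 1 else 0 := by
      intro i
      rw [view_concat]
      split_ifs <;> simp
    simp_rw [this, Finset.sum_add_distrib, ih]
    simp

theorem sum_endEvent {T : ℕ} (hT : P.cost ≤ T) (x : Fin k → X)
    (s : Finset (BoundedList (ChannelBit k) T × Bool)) :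
    ∑ t ∈ s, P.coinLaw.real (P.endEvent x t.1.1 t.2)
      = P.coinLaw.real (⋃ t ∈ s, P.endEvent x t.1.1 t.2) := by
  refine (measureReal_biUnion_finset ?_ fun t _ => measurableSet_endEvent x _ _).symm
  rintro ⟨⟨h, hh⟩, b⟩ _ ⟨⟨h', hh'⟩, b'⟩ _ hne
  rw [Function.onFun, Set.disjoint_left]
  intro r hr hr'
  rw [mem_endEvent] at hr hr'
  refine hne ?_
  have e1 := history_eq_of_exists hT hr.1 hr.2
  have e2 := history_eq_of_exists hT hr'.1 hr'.2
  have e3 : h = h' := e1.symm.trans e2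
  subst e3
  have e4 := hr.2.symm.trans hr'.2
  simp only [CoordMove.output.injEq] at e4
  simp only [e4]

theorem iUnion_endEvent {T : ℕ} (hT : P.cost ≤ T) (x : Fin k → X) :
    ⋃ t ∈ (Finset.univ : Finset (BoundedList (ChannelBit k) T × Bool)),
      P.endEvent x t.1.1 t.2 = Set.univ := by
  refine Set.eq_univ_of_forall fun r => ?_
  obtain ⟨b, hb⟩ := exists_output hT x r
  simp only [Finset.mem_univ, Set.iUnion_true, Set.mem_iUnion]
  exact ⟨⟨⟨P.history x r T, history_length_le hT x r T⟩, b⟩, mem_endEvent.2 ⟨⟨T, rfl⟩, hb⟩⟩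

/-- The transcript law of a protocol of cost at most `T`, with inputs encoded by Boolean
functions. -/
noncomputable def transcriptLaw (P : StarProtocol k X) {T : ℕ} (hT : P.cost ≤ T) {B : Type*}
    (enc : (B → Bool) → X) :
    TranscriptLaw k B (BoundedList (ChannelBit k) T × Bool) (BoundedList (Bool × Bool) T) where
  -- The answer is part of the transcript because it may still depend on the coordinator's coins.
  coord t := P.coordLaw.real {ρ | P.CoordOK ρ t.1.1 ∧ P.next ρ t.1.1 = .output t.2}
  factor i x v := (P.playerLaw i).real {ρ | P.PlayerOK i (enc x) ρ (addChannel i v.1)}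
  -- Without the channel label the views of all players share one type, so one code serves them all.
  view i t := ⟨stripChannel (view i t.1.1), by
    rw [stripChannel, List.length_map]
    exact (List.length_filter_le _ _).trans t.1.2⟩
  coord_nonneg _ := measureReal_nonneg
  factor_nonneg _ _ _ := measureReal_nonneg
  sum_eq_one Y := by
    simp_rw [addChannel_stripChannel_view, ← coinLaw_endEvent (fun i => enc (Y i))]
    rw [sum_endEvent hT, iUnion_endEvent hT, probReal_univ]

theorem transcriptLaw_prob {T : ℕ} (hT : P.cost ≤ T) {B : Type*} (enc : (B → Bool) → X)
    (Y : Fin k → B → Bool) (t : BoundedList (ChannelBit k) T × Bool) :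
    (P.transcriptLaw hT enc).prob Y t
      = P.coinLaw.real (P.endEvent (fun i => enc (Y i)) t.1.1 t.2) := by
  rw [coinLaw_endEvent]
  simp only [TranscriptLaw.prob, transcriptLaw, addChannel_stripChannel_view]

theorem sum_transcriptLaw_error_le {T : ℕ} (hT : P.cost ≤ T) {B : Type*} (enc : (B → Bool) → X)
    {f : (Fin k → X) → Bool} {δ : ℝ} (hf : P.ComputesWithError f δ) (Y : Fin k → B → Bool) :
    ∑ t, (P.transcriptLaw hT enc).prob Y t * (if t.2 = f (fun i => enc (Y i)) then 0 else 1)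
      ≤ δ := by
  refine le_trans ?_ (hf fun i => enc (Y i))
  simp_rw [transcriptLaw_prob, mul_ite, mul_zero, mul_one]
  rw [Finset.sum_ite, Finset.sum_const_zero, zero_add, sum_endEvent hT]
  refine measureReal_mono ?_
  intro r hr
  simp only [Finset.mem_filter, Finset.mem_univ, true_and, Set.mem_iUnion, exists_prop] at hr
  obtain ⟨t, hne, ht⟩ := hr
  rintro ⟨s, hs⟩
  rw [mem_endEvent] at ht
  have e1 := history_eq_of_exists hT ht.1 ht.2
  have e2 := history_eq_of_exists hT ⟨s, rfl⟩ hs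
  rw [← e2, e1, ht.2] at hs
  simp only [CoordMove.output.injEq] at hs
  exact hne hs

end StarProtocol

/-! ### Every player must be heard: the bound of order `k` -/

namespace TranscriptLaw

variable {k m ℓ : ℕ} {τ V : Type*} [Fintype τ] [DecidableEq V]

/-- If flipping the input of player `i` flips the value, then the view of player `i` is often
different from a view whose probability does not depend on the input. -/
theorem one_sub_le_sum_view_ne {B : Type*} {L : TranscriptLaw k B τ V} {v₀ : V}
    (hv : ∀ i x x', L.factor i x v₀ = L.factor i x' v₀) (ans : τ → Bool) {δ : ℝ} {i : Fin k}
    {X X' : Fin k → B → Bool} (hX : ∀ l, l ≠ i → X' l = X l)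
    (h : ∑ t, L.prob X t * (if ans t = true then 0 else 1) ≤ δ)
    (h' : ∑ t, L.prob X' t * (if ans t = false then 0 else 1) ≤ δ) :
    1 - 2 * δ ≤ ∑ t, L.prob X t * (if L.view i t = v₀ then 0 else 1) := by
  have h0 : ∀ X t, 0 ≤ L.prob X t := fun X t =>
    mul_nonneg (L.coord_nonneg t) (Finset.prod_nonneg fun i _ => L.factor_nonneg _ _ _)
  -- When the view is `v₀` both laws agree at `t`, and the answer is wrong for one of the two
  -- inputs.
  have hpt : ∀ t, L.prob X t ≤ L.prob X t * (if L.view i t = v₀ then 0 else 1)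
      + L.prob X t * (if ans t = true then 0 else 1)
      + L.prob X' t * (if ans t = false then 0 else 1) := by
    intro t
    by_cases hvt : L.view i t = v₀
    · have heq : L.prob X t = L.prob X' t := by
        unfold prob
        congr 1
        refine Finset.prod_congr rfl fun l _ => ?_
        by_cases hl : l = i
        · subst hl; rw [hvt]; exact hv _ _ _
        · rw [hX l hl]
      cases ans t <;> simp [hvt, heq]
    · have := h0 X' t
      have := h0 X t
      rw [if_neg hvt]
      split_ifs <;> simp_all
  have h1 : ∑ t, L.prob X t = 1 := L.sum_eq_one X
  have := Finset.sum_le_sum fun t (_ : t ∈ Finset.univ) => hpt t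
  rw [Finset.sum_add_distrib, Finset.sum_add_distrib, h1] at this
  linarith

/-- In a protocol for `Tribes` the total length of the views is at least of the order of the number
of players. -/
theorem players_le_cost {L : TranscriptLaw k (Fin m × Fin ℓ) τ V} (hm : 1 ≤ m) (hℓ : 1 ≤ ℓ)
    {v₀ : V} (hv : ∀ i x x', L.factor i x v₀ = L.factor i x' v₀) (ans : τ → Bool) {δ : ℝ}
    (herr : ∀ X, ∑ t, L.prob X t * (if ans t = tribesValue X then 0 else 1) ≤ δ)
    {T : ℝ} (hT : ∀ t, ∑ i, (if L.view i t = v₀ then (0 : ℝ) else 1) ≤ T) :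
    (1 - 2 * δ) * k ≤ T := by
  let X : Fin k → Fin m × Fin ℓ → Bool := fun _ _ => true
  let X' : Fin k → Fin k → Fin m × Fin ℓ → Bool := fun i l _ => decide (l ≠ i)
  have hXv : tribesValue X = true := by
    simp only [tribesValue, decide_eq_true_eq]
    exact fun a => ⟨⟨0, hℓ⟩, fun i => rfl⟩
  have hXv' : ∀ i, tribesValue (X' i) = false := by
    intro i
    simp only [tribesValue, decide_eq_false_iff_not, not_forall, not_exists]
    exact ⟨⟨0, hm⟩, fun j => ⟨i, by simp [X']⟩⟩
  have h : ∀ i, 1 - 2 * δ ≤ ∑ t, L.prob X t * (if L.view i t = v₀ then 0 else 1) := by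
    intro i
    refine one_sub_le_sum_view_ne hv ans (X' := X' i) (fun l hl => ?_) ?_ ?_
    · funext b; simp [X, X', hl]
    · simpa [hXv] using herr X
    · simpa [hXv'] using herr (X' i)
  have hsum := Finset.sum_le_sum fun i (_ : i ∈ Finset.univ) => h i
  rw [Finset.sum_comm] at hsum
  simp_rw [← Finset.mul_sum] at hsum
  rw [Finset.sum_const, Finset.card_univ, Fintype.card_fin, nsmul_eq_mul, mul_comm] at hsum
  refine hsum.trans ?_
  have h1 : ∑ t, L.prob X t = 1 := L.sum_eq_one X
  calc _ ≤ ∑ t, L.prob X t * T := Finset.sum_le_sum fun t _ => mul_le_mul_of_nonneg_left (hT t)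
        (mul_nonneg (L.coord_nonneg t) (Finset.prod_nonneg fun i _ => L.factor_nonneg _ _ _))
    _ = T := by rw [← Finset.sum_mul, h1, one_mul]

end TranscriptLaw

/-! ### The lower bound for protocols -/

namespace StarProtocol

variable {k m ℓ : ℕ} {X : Type} {P : StarProtocol k X}

/-- A protocol whose inputs encode `Tribes` instances needs at least a constant number of bits per
player. -/
theorem players_le_cost {T : ℕ} (hT : P.cost ≤ T) (enc : (Fin m × Fin ℓ → Bool) → X)
    {f : (Fin k → X) → Bool} (hf : ∀ Y, f (fun i => enc (Y i)) = TranscriptLaw.tribesValue Y)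
    {δ : ℝ} (hP : P.ComputesWithError f δ) (hm : 1 ≤ m) (hℓ : 1 ≤ ℓ) :
    (1 - 2 * δ) * k ≤ T := by
  classical
  -- The empty view is consistent with all coins of a player, whatever the input.
  refine TranscriptLaw.players_le_cost (L := P.transcriptLaw hT enc) hm hℓ (v₀ := ⟨[], by simp⟩)
    (fun i x x' => ?_) (fun t => t.2) (fun Y => ?_) fun t => ?_
  · simp [transcriptLaw, addChannel, playerOK_nil]
  · simpa [hf] using sum_transcriptLaw_error_le hT enc hP Y
  · calc _ ≤ ∑ i, ((view i t.1.1).length : ℝ) := by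
          refine Finset.sum_le_sum fun i _ => ?_
          split_ifs with h
          · positivity
          · have : view i t.1.1 ≠ [] := fun h0 => h (Subtype.ext (by
              simp [transcriptLaw, stripChannel, h0]))
            exact_mod_cast List.length_pos_iff.2 this
      _ ≤ T := by
          rw [← Nat.cast_sum, sum_length_view]
          exact_mod_cast t.1.2

/-- A protocol whose inputs encode `Tribes` instances needs a constant number of bits per cell, up
to a constant number of bits per player. -/
theorem cells_le_cost {T : ℕ} (hT : P.cost ≤ T) (enc : (Fin m × Fin ℓ → Bool) → X)
    {f : (Fin k → X) → Bool} (hf : ∀ Y, f (fun i => enc (Y i)) = TranscriptLaw.tribesValue Y)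
    {δ : ℝ} (hδ : 0 ≤ 1 - 2 * δ) (hP : P.ComputesWithError f δ) (hk : 1 ≤ k) (hℓ : 1 ≤ ℓ) :
    m * (ℓ - 1 : ℝ) * (k - 1) * (1 - 2 * δ) ^ 2 ≤ 34560 * (T + k) := by
  classical
  have h := TranscriptLaw.tribes_le_sum_len (L := P.transcriptLaw hT enc) hk hℓ (fun t => t.2) hδ
    (fun Y => by simpa [hf] using sum_transcriptLaw_error_le hT enc hP Y)
    (len := fun v => (v.1.length + 1) * Real.log 8) (sum_exp_neg_length_le T)
    (Λ := (T + k) * Real.log 8) fun t => by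
      rw [← Finset.sum_mul, Finset.sum_add_distrib]
      refine mul_le_mul_of_nonneg_right (add_le_add ?_ (by simp)) (Real.log_nonneg (by norm_num))
      simp only [transcriptLaw, stripChannel, List.length_map]
      rw [← Nat.cast_sum, sum_length_view]
      exact_mod_cast t.1.2
  have hlog : Real.log 8 ≤ 3 := by
    have h8 : (8 : ℝ) = 2 ^ 3 := by norm_num
    rw [h8, Real.log_pow]
    have := Real.log_two_lt_d9
    push_cast
    linarith
  have : (0 : ℝ) ≤ T + k := by positivity
  nlinarith [mul_le_mul_of_nonneg_left hlog this]

/-- The constant in the lower bound, in terms of the advantage over guessing. -/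
noncomputable def boundConst (ε : ℝ) : ℝ := min ε (ε ^ 2 / (138240 * (1 + 1 / ε)))

theorem boundConst_pos {ε : ℝ} (hε : 0 < ε) : 0 < boundConst ε := lt_min hε (by positivity)

theorem boundConst_mul_le {T : ℕ} (hT : P.cost ≤ T) (enc : (Fin m × Fin ℓ → Bool) → X)
    {f : (Fin k → X) → Bool} (hf : ∀ Y, f (fun i => enc (Y i)) = TranscriptLaw.tribesValue Y)
    {δ : ℝ} (hδ : 0 < 1 - 2 * δ) (hP : P.ComputesWithError f δ) (hk : 2 ≤ k) (hℓ : 2 ≤ ℓ) :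
    boundConst (1 - 2 * δ) * (m * ℓ * k) ≤ T := by
  rcases Nat.eq_zero_or_pos m with rfl | hm
  · simp
  have h1 := players_le_cost hT enc hf hP hm (by omega)
  have h2 := cells_le_cost hT enc hf hδ.le hP (by omega) (by omega)
  set ε := 1 - 2 * δ
  have hk' : (2 : ℝ) ≤ k := by exact_mod_cast hk
  have hℓ' : (2 : ℝ) ≤ ℓ := by exact_mod_cast hℓ
  have h3 : (ℓ : ℝ) * k ≤ 4 * ((ℓ - 1) * (k - 1)) := by nlinarith
  -- The bound per player absorbs the overhead `k` of the code; then 138240 = 4 · 34560.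
  have h4 : (k : ℝ) ≤ 1 / ε * T := by
    rw [one_div, ← div_eq_inv_mul, le_div_iff₀ hδ]
    linarith
  have h5 : (m * ℓ * k : ℝ) * ε ^ 2 ≤ 138240 * (1 + 1 / ε) * T := by
    have := mul_le_mul_of_nonneg_left h3 (by positivity : (0 : ℝ) ≤ m * ε ^ 2)
    nlinarith
  calc boundConst ε * (m * ℓ * k) ≤ ε ^ 2 / (138240 * (1 + 1 / ε)) * (m * ℓ * k) :=
        mul_le_mul_of_nonneg_right (min_le_right _ _) (by positivity)
    _ ≤ T := by
        rw [div_mul_eq_mul_div, div_le_iff₀ (by positivity)]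
        linarith

theorem ofReal_le_cost {z : ℝ} (h : ∀ T : ℕ, P.cost ≤ T → z ≤ T) :
    ENNReal.ofReal z ≤ (P.cost : ℝ≥0∞) := by
  cases hc : P.cost using ENat.recTopCoe with
  | top => simp
  | coe T =>
    rw [ENat.toENNReal_coe]
    exact ENNReal.ofReal_le_natCast.2 (h T hc.le)

end StarProtocol

theorem theorem1 (δ : ℝ) (hδ : δ < 1 / 2) :
    ∃ c : ℝ, 0 < c ∧
      (∀ k m ℓ : ℕ, 2 ≤ k → 2 ≤ ℓ →
        ∀ P : StarProtocol k (Fin m → Fin ℓ → Bool),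
          P.ComputesWithError (tribes k m ℓ) δ →
            ENNReal.ofReal (c * (m * ℓ * k)) ≤ (P.cost : ℝ≥0∞)) ∧
      (∀ k n : ℕ, 2 ≤ k →
        ∀ P : StarProtocol k (Fin n → Bool),
          P.ComputesWithError (setDisj k n) δ →
            ENNReal.ofReal (c * (k * n)) ≤ (P.cost : ℝ≥0∞)) := by
  have hε : 0 < 1 - 2 * δ := by linarith
  refine ⟨StarProtocol.boundConst (1 - 2 * δ), StarProtocol.boundConst_pos hε, ?_, ?_⟩
  · intro k m ℓ hk hℓ P hP
    refine StarProtocol.ofReal_le_cost fun T hT => ?_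
    exact StarProtocol.boundConst_mul_le hT (fun Y a j => Y (a, j))
      (fun Y => by simp [tribes, setDisj, TranscriptLaw.tribesValue]) hε hP hk hℓ
  · intro k n hk P hP
    refine StarProtocol.ofReal_le_cost fun T hT => ?_
    have hf : ∀ Y : Fin k → Fin 1 × Fin n → Bool,
        setDisj k n (fun i j => Y i (0, j)) = TranscriptLaw.tribesValue Y := fun Y => by
      simp [setDisj, TranscriptLaw.tribesValue]
    rcases Nat.lt_or_ge n 2 with hn | hn
    · rcases Nat.eq_zero_or_pos n with rfl | hn0
      · simp
      · obtain rfl : n = 1 := by omega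
        -- With a single column there is no unplanted one, and the bound per player suffices; hence
        -- the minimum in `boundConst`.
        have h := StarProtocol.players_le_cost hT (fun y j => y ((0 : Fin 1), j)) hf hP le_rfl le_rfl
        refine le_trans ?_ h
        rw [Nat.cast_one, mul_one]
        exact mul_le_mul_of_nonneg_right (min_le_left _ _) (by positivity)
    · have h := StarProtocol.boundConst_mul_le hT (fun y j => y ((0 : Fin 1), j)) hf hε hP hk hn
      rw [Nat.cast_one, one_mul] at h
      rwa [mul_comm (k : ℝ)]
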